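/- Bounded operators $T_1:X_1\to Y_1$ and $T_2:X_2\to Y_2$ are \emph{topologically equivalent} if $T_1=V^{-1}T_2U$ for some isomorphisms (linear homeomorphisms onto) $U:X_1\to X_2$, $V:Y_1\to Y_2$. Let $T:H\to H'$ be a bounded operator between complex Hilbert spaces and let $\mathcal E$ be the spectral measure of $\sqrt{T^*T}$. The \emph{dimension spectral measure} of $T$ is the cardinal-valued $\sigma$-additive measure $\mathcal D_T(S)=\dim\mathcal E(S)H$ (Hilbert dimension) on the Borel sets $S\subseteq[0,\infty)$. A cardinal-valued measure $m'$ on $[0,\infty)$ is obtained from $m$ by a \emph{uniformly log-bounded shift} if mass can be transferred from $m$ to $m'$ over uniformly bounded log-distances: there are $C>1$ and a cardinal-valued $\sigma$-additive measure $P$ on the Borel sets of $[0,\infty)^2$ with marginals $m$ and $m'$ and with $P=0$ outside $\{(x,y): x\le Cy,\ y\le Cx\}$ (so mass at $0$ stays at $0$). An \emph{eigenvalue sequence with infinity intermissions} $s$ consists of a strictly decreasing sequence $\lambda_0>\lambda_1>\cdots>0$ tending to $0$ with $\lambda_k/\lambda_{k+1}\ge c$ for all $k$, for some $c>1$, and of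 cardinal weights at $0$ and at each $\lambda_k$. A point $\lambda_k$ of finite weight $n$ stands for $n$ equal successive terms of a non-increasing sequence of eigenvalues; a $\lambda_k$ of infinite weight is an infinity intermission. Identify $s$ with the cardinal-valued measure having these masses. We call $s$ an eigenvalue sequence with infinity intermissions \emph{of $T$} if it is obtained from $\mathcal D_T$ by a uniformly log-bounded shift. \textbf{Theorem.} Let $T_1:H_1\to H_1'$ and $T_2:H_2\to H_2'$ be bounded operators between complex Hilbert spaces. (a) For every strictly decreasing sequence $\lambda_k>0$ tending to $0$ for which $\lambda_k/\lambda_{k+1}$ is bounded and bounded away from $1$, each of $T_1,T_2$ has an eigenvalue sequence with infinity intermissions with points $\lambda_k$. (b) Let $s_1,s_2$ be any eigenvalue sequences with infinity intermissions of $T_1,T_2$. Then $T_1$ and $T_2$, regarded as operators from their domains into the closures of their images, are topologically equivalent if and only if $s_2$ is obtained from $s_1$ by a uniformly log-bounded shift. Moreover, $T_1:H_1\to H_1'$ and $T_2:H_2\to H_2'$ themselves are topologically equivalent if and only if, in addition, $\dim (T_1H_1)^\perp=\dim (T_2H_2)^\perp$ (Hilbert dimensions). -/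

import Mathlib

open scoped NNReal InnerProductSpace Topology
open MeasureTheory Filter

universe u v

noncomputable section

/-- `T₁` and `T₂` are topologically equivalent: `T₁ = V⁻¹ T₂ U` for isomorphisms (linear
homeomorphisms onto) `U` of the domains and `V` of the codomains. -/
def TopEquivalent {X₁ Y₁ X₂ Y₂ : Type*}
    [NormedAddCommGroup X₁] [NormedSpace ℂ X₁] [NormedAddCommGroup Y₁] [NormedSpace ℂ Y₁]
    [NormedAddCommGroup X₂] [NormedSpace ℂ X₂] [NormedAddCommGroup Y₂] [NormedSpace ℂ Y₂]
    (T₁ : X₁ →L[ℂ] Y₁) (T₂ : X₂ →L[ℂ] Y₂) : Prop :=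
  ∃ (U : X₁ ≃L[ℂ] X₂) (V : Y₁ ≃L[ℂ] Y₂),
    T₁ = (V.symm : Y₂ →L[ℂ] Y₁) ∘L T₂ ∘L (U : X₁ →L[ℂ] X₂)

section HilbertSpace

variable {H : Type u} [NormedAddCommGroup H] [InnerProductSpace ℂ H]
variable {K : Type v} [NormedAddCommGroup K] [InnerProductSpace ℂ K]

/-- The operator `T`, viewed as an operator from its domain to the closure of its image. -/
def toClosureRange (T : H →L[ℂ] K) : H →L[ℂ] (LinearMap.range T.toLinearMap).topologicalClosure :=
  T.codRestrict _ fun x => Submodule.le_topologicalClosure _ ⟨x, rfl⟩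

/-- The Hilbert dimension: the cardinality of a Hilbert (that is, complete orthonormal) basis.
All such bases of a Hilbert space have the same cardinality. -/
def hilbertDim (H : Type u) [NormedAddCommGroup H] [InnerProductSpace ℂ H] : Cardinal.{u} :=
  sInf {κ | ∃ (ι : Type u) (_ : HilbertBasis ι ℂ H), Cardinal.mk ι = κ}

variable [CompleteSpace H] [CompleteSpace K]

/-- The absolute value `√(T*T)` of a bounded operator between Hilbert spaces. -/
def absOp (T : H →L[ℂ] K) : H →L[ℂ] H :=
  CFC.sqrt (ContinuousLinearMap.adjoint T ∘L T)

/-- The positive functional `f ↦ ⟨f(A) x, x⟩` on continuous compactly supported functions on the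
real line, for a self-adjoint operator `A` (`f(A)` is the continuous functional calculus). -/
def spectralFunctional (A : H →L[ℂ] H) (x : H) : CompactlySupportedContinuousMap ℝ ℝ →ₚ[ℝ] ℝ :=
  PositiveLinearMap.mk₀
    { toFun := fun f => (⟪x, cfc (fun t => f t) A x⟫_ℂ).re
      map_add' := fun f g => by
        have h : cfc (fun t => (f + g) t) A = cfc (fun t => f t) A + cfc (fun t => g t) A := by
          simp only [CompactlySupportedContinuousMap.coe_add, Pi.add_apply]
          exact cfc_add _ _ _ f.continuous.continuousOn g.continuous.continuousOn
        rw [h, add_apply, inner_add_right, Complex.add_re]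
      map_smul' := fun c f => by
        have h : cfc (fun t => (c • f) t) A = c • cfc (fun t => f t) A := by
          simp only [CompactlySupportedContinuousMap.coe_smul, Pi.smul_apply]
          exact cfc_smul c _ _ f.continuous.continuousOn
        rw [h, smul_apply, inner_smul_right_eq_smul]
        simp }
    fun f hf => by
      have h : 0 ≤ cfc (fun t => f t) A := cfc_nonneg fun t _ => hf t
      have h' := ((ContinuousLinearMap.nonneg_iff_isPositive _).1 h).inner_nonneg_right x
      exact (Complex.le_def.1 h').1

/-- The scalar spectral measure `S ↦ ⟨E(S) x, x⟩` of a self-adjoint operator `A` at the vector `x`,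
where `E` is the spectral measure of `A`: the regular Borel measure on the real line with
`∫ f d⟨E x, x⟩ = ⟨f(A) x, x⟩`, obtained from the Riesz representation theorem. -/
def scalarSpectralMeasure (A : H →L[ℂ] H) (x : H) : Measure ℝ :=
  RealRMK.rieszMeasure (spectralFunctional A x)

instance (A : H →L[ℂ] H) (x : H) : (scalarSpectralMeasure A x).Regular :=
  RealRMK.regular_rieszMeasure _

theorem integral_scalarSpectralMeasure (A : H →L[ℂ] H) (x : H)
    (f : CompactlySupportedContinuousMap ℝ ℝ) :
    ∫ t, f t ∂(scalarSpectralMeasure A x) = (⟪x, cfc (fun t => f t) A x⟫_ℂ).re :=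
  RealRMK.integral_rieszMeasure _ f

theorem scalarSpectralMeasure_zero (A : H →L[ℂ] H) : scalarSpectralMeasure A 0 = 0 := by
  refine Measure.ext_of_integral_eq_on_compactlySupported fun f => ?_
  rw [integral_scalarSpectralMeasure]
  simp

theorem scalarSpectralMeasure_smul (A : H →L[ℂ] H) (c : ℂ) (x : H) :
    scalarSpectralMeasure A (c • x) = ‖c‖₊ ^ 2 • scalarSpectralMeasure A x := by
  refine Measure.ext_of_integral_eq_on_compactlySupported fun f => ?_
  rw [integral_smul_nnreal_measure, integral_scalarSpectralMeasure,
    integral_scalarSpectralMeasure, map_smul, inner_smul_left, inner_smul_right, ← mul_assoc,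
    Complex.conj_mul', NNReal.smul_def, smul_eq_mul]
  norm_cast
  rw [Complex.re_ofReal_mul]
  simp

theorem scalarSpectralMeasure_parallelogram (A : H →L[ℂ] H) (x y : H) :
    scalarSpectralMeasure A (x + y) + scalarSpectralMeasure A (x - y) =
      (2 : ℝ≥0) • (scalarSpectralMeasure A x + scalarSpectralMeasure A y) := by
  have hr : ∀ a b : H, (scalarSpectralMeasure A a + scalarSpectralMeasure A b).Regular := by
    intro a b
    have : IsLocallyFiniteMeasure (scalarSpectralMeasure A a + scalarSpectralMeasure A b) := by
      have : IsFiniteMeasureOnCompacts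
          (scalarSpectralMeasure A a + scalarSpectralMeasure A b) := by
        refine ⟨fun k hk => ?_⟩
        rw [Measure.add_apply]
        exact ENNReal.add_lt_top.2 ⟨hk.measure_lt_top, hk.measure_lt_top⟩
      infer_instance
    infer_instance
  have := hr (x + y) (x - y)
  have := hr x y
  refine Measure.ext_of_integral_eq_on_compactlySupported fun f => ?_
  have hi : ∀ z, Integrable (fun t => f t) (scalarSpectralMeasure A z) := fun z =>
    f.continuous.integrable_of_hasCompactSupport f.hasCompactSupport
  rw [integral_smul_nnreal_measure, integral_add_measure (hi _) (hi _),
    integral_add_measure (hi _) (hi _)]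
  simp only [integral_scalarSpectralMeasure, map_add, map_sub, inner_add_left, inner_add_right,
    inner_sub_left, inner_sub_right, Complex.add_re, Complex.sub_re, NNReal.smul_def, smul_eq_mul]
  norm_num
  ring

/-- The subspace `E(S)H`, where `E` is the spectral measure of the self-adjoint operator `A` and
`S` is a Borel set of real numbers: it consists of the vectors `x` with
`‖E(Sᶜ) x‖² = ⟨E(Sᶜ) x, x⟩ = 0`. -/
def spectralSubspace (A : H →L[ℂ] H) (S : Set ℝ) : Submodule ℂ H where
  carrier := {x | scalarSpectralMeasure A x Sᶜ = 0}
  zero_mem' := by simp [scalarSpectralMeasure_zero]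
  add_mem' := fun {x y} hx hy => by
    have h := congrArg (fun m : Measure ℝ => m Sᶜ) (scalarSpectralMeasure_parallelogram A x y)
    simp only [Set.mem_ofPred_eq] at hx hy ⊢
    simp only [Measure.add_apply, Measure.smul_apply, hx, hy, add_zero, smul_zero] at h
    exact (add_eq_zero.1 h).1
  smul_mem' := fun c x hx => by
    simp only [Set.mem_ofPred_eq] at hx ⊢
    rw [scalarSpectralMeasure_smul, Measure.smul_apply, hx, smul_zero]

/-- The dimension spectral measure of `T`: it sends a Borel set `S ⊆ [0, ∞)` to the Hilbert
dimension of `E(S)H`, where `E` is the spectral measure of `√(T*T)`. -/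
def dimSpectralMeasure (T : H →L[ℂ] K) (S : Set ℝ≥0) : Cardinal.{u} :=
  hilbertDim (spectralSubspace (absOp T) ((fun t : ℝ≥0 => (t : ℝ)) '' S))

end HilbertSpace

/-- A set function on the Borel sets which is a `σ`-additive measure with values in the cardinal
numbers. (Its values on sets that are not Borel are irrelevant.) -/
structure IsCardinalMeasure {α : Type*} [MeasurableSpace α] (m : Set α → Cardinal.{u}) : Prop where
  empty : m ∅ = 0
  iUnion : ∀ S : ℕ → Set α, (∀ n, MeasurableSet (S n)) → Pairwise (Function.onFun Disjoint S) →
    m (⋃ n, S n) = Cardinal.sum fun n => m (S n)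

/-- The points `x, y ∈ [0, ∞)` are at log-distance at most `log C`: either both are zero, or both
are positive and `C⁻¹ ≤ x / y ≤ C`. -/
def LogClose (C x y : ℝ≥0) : Prop := x ≤ C * y ∧ y ≤ C * x

/-- The measure `m'` is obtained from `m` by a uniformly log-bounded shift: the masses of `m` can
be transferred to uniformly log-bounded distances so as to give `m'`. The transfer is described
by a cardinal-valued measure `P` on `[0, ∞) × [0, ∞)`, where `P (S ×ˢ S')` is the mass which is
moved from `S` into `S'`. -/
def LogBoundedShift (m m' : Set ℝ≥0 → Cardinal.{u}) : Prop :=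
  ∃ (C : ℝ≥0) (P : Set (ℝ≥0 × ℝ≥0) → Cardinal.{u}), 1 < C ∧ IsCardinalMeasure P ∧
    (∀ S, MeasurableSet S → P (S ×ˢ Set.univ) = m S) ∧
    (∀ S, MeasurableSet S → P (Set.univ ×ˢ S) = m' S) ∧
    P {p | ¬ LogClose C p.1 p.2} = 0

/-- A strictly decreasing sequence of positive numbers that tends to `0`, with log-distances of
successive terms uniformly bounded below. -/
structure IsLogSeparated (lam : ℕ → ℝ≥0) : Prop where
  pos : ∀ k, 0 < lam k
  strictAnti : StrictAnti lam
  tendsto_zero : Tendsto lam atTop (𝓝 0)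
  separated : ∃ C : ℝ≥0, 1 < C ∧ ∀ k, C * lam (k + 1) ≤ lam k

/-- An eigenvalue sequence with infinity intermissions: mass at `0` and at the points of a
log-separated sequence. A point `point k` of finite weight `n` stands for `n` successive equal
terms `point k` of the non-increasing sequence of eigenvalues (none if `n = 0`); a point of infinite
weight is an infinity intermission, carrying that infinite cardinal. -/
structure EigenvalueSequence where
  point : ℕ → ℝ≥0
  isLogSeparated : IsLogSeparated point
  zeroWeight : Cardinal.{u}
  weight : ℕ → Cardinal.{u}

namespace EigenvalueSequence

open scoped Classical in
/-- The cardinal-valued measure with the given masses at `0` and at the points. -/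
def toMeasure (s : EigenvalueSequence.{u}) (S : Set ℝ≥0) : Cardinal.{u} :=
  (if (0 : ℝ≥0) ∈ S then s.zeroWeight else 0) +
    Cardinal.sum fun k => if s.point k ∈ S then s.weight k else 0

/-- `s` is an eigenvalue sequence with infinity intermissions of the operator `T`: it is obtained
from the dimension spectral measure of `T` by a uniformly log-bounded shift. -/
def IsOf {H : Type u} [NormedAddCommGroup H] [InnerProductSpace ℂ H] [CompleteSpace H]
    {K : Type v} [NormedAddCommGroup K] [InnerProductSpace ℂ K] [CompleteSpace K]
    (s : EigenvalueSequence.{u}) (T : H →L[ℂ] K) : Prop :=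
  LogBoundedShift (dimSpectralMeasure T) s.toMeasure

end EigenvalueSequence

end

/-! Everything passes through one relation between cardinal-valued measures, `MutuallySpread`: for
some `C > 1` the mass of every interval `[a, b]` is at most the mass the other measure gives to `[a
/ C, C * b]`, in both directions. It is visibly symmetric and transitive, so the measures of the
operators and of their eigenvalue sequences can be linked in chains without composing shifts.

A log-bounded shift implies this relation, since mass over `[a, b]` lands in the enlarged interval.
Topological equivalence implies it for the dimension spectral measures. Indeed, an equivalence is an
isomorphism `U` for which `‖T₁ x‖` and `‖T₂ (U x)‖` are comparable (`NormComparable`), and then `U`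
followed by the projection onto the spectral subspace of the enlarged interval is injective on the
spectral subspace of `[a, b]` (`NormComparable.eq_zero_of_inner_eq_zero`). An injective bounded
operator cannot lower the Hilbert dimension.

Conversely, for two eigenvalue sequences the interval condition produces a shift. Units of mass are
matched by Hall's marriage theorem where all targets in reach are finite and by absorption into
infinite weights elsewhere; Schröder–Bernstein turns two injections into a bijection
(`exists_injective_logClose`, `exists_equiv_logClose`).

To return from sequences to operators, round the spectrum of `√(T*T)` to a grid with bounded ratios.
This gives part (a), and it makes `T` diagonal up to bounded factors
(`exists_hilbertBasis_diagonal`). Matching the basis vectors of `T₁` and `T₂` along the bijection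
gives a unitary `U` with comparable norms. The induced map between the images then extends to their
closures, and to the whole codomains when the orthogonal complements of the images have equal
dimension. -/

section ScalarSpectralMeasure

/-! ### Scalar spectral measures and the continuous functional calculus -/

variable {H : Type u} [NormedAddCommGroup H] [InnerProductSpace ℂ H] [CompleteSpace H]
  {A : H →L[ℂ] H} {x y : H}

/-- A bump function equal to `1` on a compact set off the spectrum and to `0` on the spectrum has
zero functional calculus, hence zero integral. Inner regularity on open sets does the rest. -/
theorem scalarSpectralMeasure_compl_spectrum (A : H →L[ℂ] H) (x : H) :
    scalarSpectralMeasure A x (spectrum ℝ A)ᶜ = 0 := by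
  have hcl : IsClosed (spectrum ℝ A) := spectrum.isClosed A
  rw [hcl.isOpen_compl.measure_eq_iSup_isCompact]
  simp only [ENNReal.iSup_eq_zero]
  intro F hF hFc
  obtain ⟨f, hf1, hf0, hfc, hf⟩ := exists_continuous_one_zero_of_isCompact hFc hcl
    (Set.disjoint_left.2 fun t ht => hF ht)
  let g : CompactlySupportedContinuousMap ℝ ℝ := ⟨f, hfc⟩
  have h0 : ∫ t, g t ∂(scalarSpectralMeasure A x) = 0 := by
    have : cfc (fun t => g t) A = cfc (fun _ : ℝ => (0 : ℝ)) A := cfc_congr hf0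
    rw [integral_scalarSpectralMeasure, this]
    simp
  have hi : Integrable g (scalarSpectralMeasure A x) :=
    g.continuous.integrable_of_hasCompactSupport g.hasCompactSupport
  have h1 := (integral_eq_zero_iff_of_nonneg (fun t => (hf t).1) hi).1 h0
  refine measure_mono_null (fun t ht => ?_) h1
  have : f t = 1 := hf1 ht
  simp [this]

theorem scalarSpectralMeasure_lt_top (A : H →L[ℂ] H) (x : H) :
    scalarSpectralMeasure A x Set.univ < ⊤ := by
  rw [← Set.union_compl_self (spectrum ℝ A)]
  refine (measure_union_le _ _).trans_lt ?_
  rw [scalarSpectralMeasure_compl_spectrum, add_zero]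
  exact (spectrum.isCompact A).measure_lt_top

instance (A : H →L[ℂ] H) (x : H) : IsFiniteMeasure (scalarSpectralMeasure A x) :=
  ⟨scalarSpectralMeasure_lt_top A x⟩

theorem ae_mem_spectrum (A : H →L[ℂ] H) (x : H) :
    ∀ᵐ t ∂(scalarSpectralMeasure A x), t ∈ spectrum ℝ A :=
  scalarSpectralMeasure_compl_spectrum A x

theorem exists_compactlySupported_eqOn_spectrum (A : H →L[ℂ] H) {f : ℝ → ℝ} (hf : Continuous f) :
    ∃ g : CompactlySupportedContinuousMap ℝ ℝ, Set.EqOn f g (spectrum ℝ A) := by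
  obtain ⟨χ, hχ1, -, hχc, -⟩ := exists_continuous_one_zero_of_isCompact (X := ℝ)
    (spectrum.isCompact A) isClosed_empty (Set.disjoint_empty _)
  refine ⟨⟨⟨fun t => f t * χ t, hf.mul χ.continuous⟩, hχc.mul_left⟩, fun t ht => ?_⟩
  have : χ t = 1 := hχ1 ht
  change f t = f t * χ t
  rw [this, mul_one]

theorem integrable_of_continuous (A : H →L[ℂ] H) (x : H) {f : ℝ → ℝ} (hf : Continuous f) :
    Integrable f (scalarSpectralMeasure A x) := by
  obtain ⟨g, hg⟩ := exists_compactlySupported_eqOn_spectrum A hf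
  refine (g.continuous.integrable_of_hasCompactSupport g.hasCompactSupport).congr ?_
  filter_upwards [ae_mem_spectrum A x] with t ht using (hg ht).symm

theorem integral_of_continuous (A : H →L[ℂ] H) (x : H) {f : ℝ → ℝ} (hf : Continuous f) :
    ∫ t, f t ∂(scalarSpectralMeasure A x) = (⟪x, cfc f A x⟫_ℂ).re := by
  obtain ⟨g, hg⟩ := exists_compactlySupported_eqOn_spectrum A hf
  rw [cfc_congr hg, ← integral_scalarSpectralMeasure]
  refine integral_congr_ae ?_
  filter_upwards [ae_mem_spectrum A x] with t ht using hg ht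

theorem inner_cfc_left (f : ℝ → ℝ) (x y : H) :
    ⟪cfc f A x, y⟫_ℂ = ⟪x, cfc f A y⟫_ℂ := by
  have h : IsSelfAdjoint (cfc f A) := IsSelfAdjoint.cfc
  exact h.isSymmetric x y

theorem norm_sq_cfc (A : H →L[ℂ] H) (x : H) {f : ℝ → ℝ} (hf : Continuous f) :
    ‖cfc f A x‖ ^ 2 = ∫ t, f t ^ 2 ∂(scalarSpectralMeasure A x) := by
  have h2 : Continuous fun t => f t ^ 2 := hf.pow 2
  rw [integral_of_continuous A x h2]
  have : cfc (fun t => f t ^ 2) A = cfc f A * cfc f A := by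
    rw [← cfc_mul f f A hf.continuousOn hf.continuousOn]
    simp only [sq]
  rw [this, mul_apply_eq_comp, ← inner_cfc_left, inner_self_eq_norm_sq_to_K]
  norm_cast

theorem enorm_sq_cfc (A : H →L[ℂ] H) (x : H) {f : ℝ → ℝ} (hf : Continuous f) :
    ‖cfc f A x‖ₑ ^ 2 = ∫⁻ t, ‖f t‖ₑ ^ 2 ∂(scalarSpectralMeasure A x) := by
  have h2 : Continuous fun t => f t ^ 2 := hf.pow 2
  have he : ∀ r : ℝ, ENNReal.ofReal (r ^ 2) = ‖r‖ₑ ^ 2 := fun r => by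
    rw [← sq_abs, ENNReal.ofReal_pow (abs_nonneg r), ← Real.norm_eq_abs, ofReal_norm]
  rw [← ofReal_norm, ← ENNReal.ofReal_pow (norm_nonneg _), norm_sq_cfc A x hf,
    ofReal_integral_eq_lintegral_ofReal (integrable_of_continuous A x h2)
      (Eventually.of_forall fun t => sq_nonneg _)]
  simp only [he]

theorem enorm_cfc (A : H →L[ℂ] H) (x : H) {f : ℝ → ℝ} (hf : Continuous f) :
    ‖cfc f A x‖ₑ = eLpNorm f 2 (scalarSpectralMeasure A x) := by
  have h := eLpNorm_nnreal_pow_eq_lintegral (f := f) (μ := scalarSpectralMeasure A x)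
    (p := 2) two_ne_zero
  have h2 := enorm_sq_cfc A x hf
  refine (ENNReal.pow_right_strictMono two_ne_zero).injective ?_
  rw [h2]
  simpa using h.symm

theorem scalarSpectralMeasure_univ (hA : IsSelfAdjoint A) (x : H) :
    (scalarSpectralMeasure A x) Set.univ = ‖x‖ₑ ^ 2 := by
  have h := enorm_sq_cfc A x (f := fun _ => 1) continuous_const
  rw [cfc_const_one ℝ A] at h
  simpa using h.symm

theorem eq_zero_of_scalarSpectralMeasure_eq_zero (hA : IsSelfAdjoint A)
    (h : scalarSpectralMeasure A x = 0) : x = 0 := by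
  have h1 := scalarSpectralMeasure_univ hA x
  simpa [h] using h1.symm

/-- Test against `g`: since functions of `A` commute and are symmetric, `⟪f(A) x, g(A) f(A) x⟫` is
the integral of `f * g * f` against the measure of `x`. -/
theorem scalarSpectralMeasure_cfc (A : H →L[ℂ] H) (x : H) {f : ℝ → ℝ} (hf : Continuous f) :
    scalarSpectralMeasure A (cfc f A x) =
      (scalarSpectralMeasure A x).withDensity fun t => ((‖f t‖₊ ^ 2 : ℝ≥0) : ENNReal) := by
  have : IsFiniteMeasure ((scalarSpectralMeasure A x).withDensity
      fun t => ((‖f t‖₊ ^ 2 : ℝ≥0) : ENNReal)) := by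
    refine isFiniteMeasure_withDensity ?_
    have := enorm_sq_cfc A x hf
    simp only [ENNReal.coe_pow]
    refine ne_of_eq_of_ne this.symm ?_
    simp
  refine Measure.ext_of_integral_eq_on_compactlySupported fun g => ?_
  have hm : Measurable fun t => ‖f t‖₊ ^ 2 := (hf.nnnorm.pow 2).measurable
  have hc : Continuous fun t => g t * f t := g.continuous.mul hf
  have hc' : Continuous fun t => f t * (g t * f t) := hf.mul hc
  rw [integral_withDensity_eq_integral_smul hm, integral_scalarSpectralMeasure, inner_cfc_left,
    ← mul_apply_eq_comp, ← mul_apply_eq_comp, mul_assoc,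
    ← cfc_mul (fun t => g t) f A g.continuous.continuousOn hf.continuousOn,
    ← cfc_mul f (fun t => g t * f t) A hf.continuousOn hc.continuousOn,
    ← integral_of_continuous A x hc']
  refine integral_congr_ae (Eventually.of_forall fun t => ?_)
  simp only [NNReal.smul_def, NNReal.coe_pow, coe_nnnorm, Real.norm_eq_abs, sq_abs, smul_eq_mul]
  ring

theorem scalarSpectralMeasure_cfc_apply (A : H →L[ℂ] H) (x : H) {f : ℝ → ℝ} (hf : Continuous f)
    {S : Set ℝ} (hS : MeasurableSet S) :
    scalarSpectralMeasure A (cfc f A x) S =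
      ∫⁻ t in S, ‖f t‖ₑ ^ 2 ∂(scalarSpectralMeasure A x) := by
  rw [scalarSpectralMeasure_cfc A x hf, withDensity_apply _ hS]
  simp only [ENNReal.coe_pow]
  rfl

theorem scalarSpectralMeasure_add_le (A : H →L[ℂ] H) (x y : H) (S : Set ℝ) :
    scalarSpectralMeasure A (x + y) S ≤
      2 * (scalarSpectralMeasure A x S + scalarSpectralMeasure A y S) := by
  have h := congrArg (fun m : Measure ℝ => m S) (scalarSpectralMeasure_parallelogram A x y)
  simp only [Measure.add_apply, Measure.smul_apply, ENNReal.smul_def] at h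
  exact le_self_add.trans h.le

/-- By the parallelogram law the mass at `x` is at most twice the sum of the mass at `u n` and the
total mass `‖x - u n‖ ^ 2` at the difference. This replaces continuity of a spectral projection. -/
theorem scalarSpectralMeasure_eq_zero_of_tendsto (hA : IsSelfAdjoint A) {u : ℕ → H}
    (hu : Tendsto u atTop (𝓝 x)) {S : Set ℝ}
    (h : Tendsto (fun n => scalarSpectralMeasure A (u n) S) atTop (𝓝 0)) :
    scalarSpectralMeasure A x S = 0 := by
  have h1 : ∀ n, scalarSpectralMeasure A x S ≤
      2 * (‖x - u n‖ₑ ^ 2 + scalarSpectralMeasure A (u n) S) := fun n => by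
    have := scalarSpectralMeasure_add_le A (x - u n) (u n) S
    rw [sub_add_cancel] at this
    refine this.trans ?_
    gcongr
    rw [← scalarSpectralMeasure_univ hA]
    exact measure_mono (Set.subset_univ _)
  have h2 : Tendsto (fun n => ‖x - u n‖ₑ) atTop (𝓝 0) := by
    have : Tendsto (fun n => x - u n) atTop (𝓝 (x - x)) := tendsto_const_nhds.sub hu
    rw [sub_self] at this
    simpa using this.enorm
  have h3 : Tendsto (fun n => 2 * (‖x - u n‖ₑ ^ 2 + scalarSpectralMeasure A (u n) S)) atTop
      (𝓝 (2 * (0 ^ 2 + 0))) :=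
    ENNReal.Tendsto.const_mul ((ENNReal.Tendsto.pow h2).add h) (Or.inr (by simp))
  refine le_antisymm ?_ bot_le
  simpa using ge_of_tendsto' h3 h1

end ScalarSpectralMeasure

/-! ### Spectral subspaces and orthogonal decompositions -/

section SpectralSubspace

variable {H : Type u} [NormedAddCommGroup H] [InnerProductSpace ℂ H] [CompleteSpace H]
  {A : H →L[ℂ] H} {x y : H} {S S' : Set ℝ}

theorem mem_spectralSubspace : x ∈ spectralSubspace A S ↔ scalarSpectralMeasure A x Sᶜ = 0 :=
  Iff.rfl

theorem ae_mem_of_mem_spectralSubspace (h : x ∈ spectralSubspace A S) :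
    ∀ᵐ t ∂(scalarSpectralMeasure A x), t ∈ S := h

theorem spectralSubspace_mono (h : S ⊆ S') : spectralSubspace A S ≤ spectralSubspace A S' :=
  fun _ hx => measure_mono_null (Set.compl_subset_compl.2 h) hx

theorem mem_spectralSubspace_compl :
    x ∈ spectralSubspace A Sᶜ ↔ scalarSpectralMeasure A x S = 0 := by
  rw [mem_spectralSubspace, compl_compl]

theorem isClosed_spectralSubspace (hA : IsSelfAdjoint A) (S : Set ℝ) :
    IsClosed (spectralSubspace A S : Set H) := by
  refine IsSeqClosed.isClosed fun u x hu hx => ?_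
  refine scalarSpectralMeasure_eq_zero_of_tendsto hA hx ?_
  have : ∀ n, scalarSpectralMeasure A (u n) Sᶜ = 0 := hu
  simp [this]

theorem exists_continuous_approx_indicator (μ : Measure ℝ) [IsFiniteMeasure μ]
    (hS : MeasurableSet S) :
    ∃ f : ℕ → ℝ → ℝ, (∀ n, Continuous (f n)) ∧
      Tendsto (fun n => eLpNorm (S.indicator 1 - f n) 2 μ) atTop (𝓝 0) := by
  have hi : MemLp (S.indicator (1 : ℝ → ℝ)) 2 μ :=
    memLp_indicator_const 2 hS 1 (Or.inr (measure_ne_top μ S))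
  have h : ∀ n : ℕ, ∃ g : ℝ → ℝ, Continuous g ∧
      eLpNorm (S.indicator 1 - g) 2 μ ≤ ((n : ENNReal) + 1)⁻¹ := fun n => by
    obtain ⟨g, -, hg, hc, -⟩ := hi.exists_hasCompactSupport_eLpNorm_sub_le (by simp)
      (ε := ((n : ENNReal) + 1)⁻¹) (by simp)
    exact ⟨g, hc, hg⟩
  choose f hf hfe using h
  refine ⟨f, hf, tendsto_of_tendsto_of_tendsto_of_le_of_le tendsto_const_nhds ?_
    (fun _ => bot_le) hfe⟩
  have := (tendsto_add_atTop_iff_nat 1).2 ENNReal.tendsto_inv_nat_nhds_zero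
  simpa using this

theorem eLpNorm_sub_le_of_indicator {μ : Measure ℝ} (hS : MeasurableSet S) {f g : ℝ → ℝ}
    (hf : Continuous f) (hg : Continuous g) :
    eLpNorm (f - g) 2 μ ≤ eLpNorm (S.indicator 1 - f) 2 μ + eLpNorm (S.indicator 1 - g) 2 μ := by
  have hi : AEStronglyMeasurable (S.indicator (1 : ℝ → ℝ)) μ :=
    (measurable_one.indicator hS).aestronglyMeasurable
  have h : f - g = (S.indicator 1 - g) - (S.indicator 1 - f) := by abel
  rw [h, add_comm]
  exact eLpNorm_sub_le (hi.sub hg.aestronglyMeasurable) (hi.sub hf.aestronglyMeasurable) (by simp)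

theorem enorm_cfc_sub_cfc (A : H →L[ℂ] H) (x : H) {f g : ℝ → ℝ} (hf : Continuous f)
    (hg : Continuous g) :
    ‖cfc f A x - cfc g A x‖ₑ = eLpNorm (f - g) 2 (scalarSpectralMeasure A x) := by
  have h := enorm_cfc A x (hf.sub hg)
  rw [← h]
  have : cfc (f - g) A = cfc f A - cfc g A := cfc_sub f g A hf.continuousOn hg.continuousOn
  rw [this]
  rfl

theorem enorm_sub_cfc (hA : IsSelfAdjoint A) (x : H) {f : ℝ → ℝ} (hf : Continuous f) :
    ‖x - cfc f A x‖ₑ = eLpNorm (1 - f) 2 (scalarSpectralMeasure A x) := by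
  have h : cfc (1 : ℝ → ℝ) A = 1 := cfc_one ℝ A
  have := enorm_cfc_sub_cfc A x (f := 1) continuous_one hf
  rwa [h] at this

theorem setLIntegral_sq_le_eLpNorm {μ : Measure ℝ} {T : Set ℝ} (hT : MeasurableSet T)
    {f g : ℝ → ℝ} (h : ∀ t ∈ T, ‖f t‖ₑ = ‖g t‖ₑ) :
    ∫⁻ t in T, ‖f t‖ₑ ^ 2 ∂μ ≤ eLpNorm g 2 μ ^ 2 := by
  have h2 := eLpNorm_nnreal_pow_eq_lintegral (f := g) (μ := μ) (p := 2) two_ne_zero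
  have h2' : eLpNorm g 2 μ ^ 2 = ∫⁻ t, ‖g t‖ₑ ^ 2 ∂μ := by simpa using h2
  rw [h2', setLIntegral_congr_fun hT (g := fun t => ‖g t‖ₑ ^ 2) fun t ht => by
    simp only [h t ht]]
  exact setLIntegral_le_lintegral _ _

/-- Here `y` plays the role of `E(S) x`. It is built as the limit of `f n (A) x`, where the
continuous `f n` tend to the indicator of `S` in `L²` of the measure of `x`; the functional calculus
is isometric from this `L²` norm to `H`. -/
theorem exists_spectral_decomposition (hA : IsSelfAdjoint A) (hS : MeasurableSet S) (x : H) :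
    ∃ y ∈ spectralSubspace A S, ∃ z ∈ spectralSubspace A Sᶜ,
      x = y + z ∧ ‖y‖ₑ ^ 2 = scalarSpectralMeasure A x S := by
  set μ := scalarSpectralMeasure A x with hμ
  obtain ⟨f, hfc, hf⟩ := exists_continuous_approx_indicator μ hS
  set ε := fun n => eLpNorm (S.indicator 1 - f n) 2 μ with hε
  have hε2 : Tendsto (fun n => ε n ^ 2) atTop (𝓝 0) := by
    simpa using ENNReal.Tendsto.pow (n := 2) hf
  have hcau : CauchySeq fun n => cfc (f n) A x := by
    rw [EMetric.cauchySeq_iff]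
    intro δ hδ
    obtain ⟨N, hN⟩ := eventually_atTop.1 (hf.eventually_lt_const (ENNReal.half_pos hδ.ne'))
    refine ⟨N, fun m hm n hn => ?_⟩
    rw [edist_eq_enorm_sub, enorm_cfc_sub_cfc A x (hfc m) (hfc n), ← ENNReal.add_halves δ]
    exact (eLpNorm_sub_le_of_indicator hS (hfc m) (hfc n)).trans_lt
      (ENNReal.add_lt_add (hN m hm) (hN n hn))
  obtain ⟨y, hy⟩ := cauchySeq_tendsto_of_complete hcau
  have hyS : y ∈ spectralSubspace A S := by
    refine scalarSpectralMeasure_eq_zero_of_tendsto hA hy ?_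
    refine tendsto_of_tendsto_of_tendsto_of_le_of_le tendsto_const_nhds hε2
      (fun _ => bot_le) fun n => ?_
    simp only
    -- Off `S` the indicator vanishes, so the mass of `f n (A) x` there is part of the squared `L²`
    -- error.
    rw [scalarSpectralMeasure_cfc_apply A x (hfc n) hS.compl]
    exact setLIntegral_sq_le_eLpNorm hS.compl fun t ht => by simp [Set.indicator_of_notMem ht]
  have hzS : x - y ∈ spectralSubspace A Sᶜ := by
    rw [mem_spectralSubspace_compl]
    refine scalarSpectralMeasure_eq_zero_of_tendsto hA (tendsto_const_nhds.sub hy) ?_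
    refine tendsto_of_tendsto_of_tendsto_of_le_of_le tendsto_const_nhds hε2
      (fun _ => bot_le) fun n => ?_
    have h1 : x - cfc (f n) A x = cfc (1 - f n) A x := by
      have : cfc (1 - f n) A = cfc 1 A - cfc (f n) A :=
        cfc_sub 1 (f n) A continuous_one.continuousOn (hfc n).continuousOn
      rw [this, cfc_one ℝ A]
      rfl
    have hc : Continuous (1 - f n) := continuous_one.sub (hfc n)
    simp only
    rw [h1, scalarSpectralMeasure_cfc_apply A x hc hS]
    exact setLIntegral_sq_le_eLpNorm hS fun t ht => by simp [Set.indicator_of_mem ht]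
  refine ⟨y, hyS, x - y, hzS, (add_sub_cancel _ _).symm, ?_⟩
  have hi : AEStronglyMeasurable (S.indicator (1 : ℝ → ℝ)) μ :=
    (measurable_one.indicator hS).aestronglyMeasurable
  have hsum : ∀ n, eLpNorm (S.indicator (1 : ℝ → ℝ)) 2 μ ≤ ε n + ‖cfc (f n) A x‖ₑ := fun n => by
    rw [enorm_cfc A x (hfc n)]
    have := eLpNorm_add_le (p := 2) (hi.sub (hfc n).aestronglyMeasurable)
      (hfc n).aestronglyMeasurable (by simp)
    rwa [sub_add_cancel] at this
  have hsum' : ∀ n, ‖cfc (f n) A x‖ₑ ≤ ε n + eLpNorm (S.indicator (1 : ℝ → ℝ)) 2 μ := fun n => by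
    rw [enorm_cfc A x (hfc n), add_comm]
    have := eLpNorm_sub_le (p := 2) hi (hi.sub (hfc n).aestronglyMeasurable) (by simp)
    rwa [sub_sub_cancel] at this
  have h1 : eLpNorm (S.indicator (1 : ℝ → ℝ)) 2 μ = ‖y‖ₑ := by
    apply le_antisymm
    · have := ge_of_tendsto' (hf.add hy.enorm) hsum
      rwa [zero_add] at this
    · have := le_of_tendsto_of_tendsto' hy.enorm (hf.add tendsto_const_nhds) hsum'
      rwa [zero_add] at this
  have h2 := eLpNorm_nnreal_pow_eq_lintegral (f := S.indicator (1 : ℝ → ℝ)) (μ := μ) (p := 2)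
    two_ne_zero
  have h2' : eLpNorm (S.indicator (1 : ℝ → ℝ)) 2 μ ^ 2 =
      ∫⁻ t, ‖S.indicator (1 : ℝ → ℝ) t‖ₑ ^ 2 ∂μ := by simpa using h2
  have h3 : ∀ t, ‖S.indicator (1 : ℝ → ℝ) t‖ₑ ^ 2 = S.indicator 1 t := fun t => by
    by_cases ht : t ∈ S <;> simp [ht]
  rw [← h1, h2']
  simp only [h3]
  exact lintegral_indicator_one hS

/-- Approximate the indicator of `S` in `L²` of the sum of both measures. Then `f n (A) x → x` and
`f n (A) y → 0`, while `f n (A)` moves across the inner product. -/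
theorem inner_eq_zero_of_mem_compl (hA : IsSelfAdjoint A) (hS : MeasurableSet S)
    (hx : x ∈ spectralSubspace A S) (hy : y ∈ spectralSubspace A Sᶜ) : ⟪x, y⟫_ℂ = 0 := by
  set μ := scalarSpectralMeasure A x + scalarSpectralMeasure A y with hμ
  obtain ⟨f, hfc, hf⟩ := exists_continuous_approx_indicator μ hS
  rw [mem_spectralSubspace_compl] at hy
  have h1 : Tendsto (fun n => cfc (f n) A x) atTop (𝓝 x) := by
    rw [tendsto_iff_edist_tendsto_0]
    refine tendsto_of_tendsto_of_tendsto_of_le_of_le tendsto_const_nhds hf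
      (fun _ => bot_le) fun n => ?_
    simp only
    rw [edist_comm, edist_eq_enorm_sub, enorm_sub_cfc hA x (hfc n)]
    refine (eLpNorm_congr_ae ?_).trans_le (eLpNorm_mono_measure _ (Measure.le_add_right le_rfl))
    filter_upwards [ae_mem_of_mem_spectralSubspace hx] with t ht
    simp [ht]
  have h2 : Tendsto (fun n => cfc (f n) A y) atTop (𝓝 0) := by
    rw [tendsto_iff_edist_tendsto_0]
    refine tendsto_of_tendsto_of_tendsto_of_le_of_le tendsto_const_nhds hf
      (fun _ => bot_le) fun n => ?_
    simp only
    rw [edist_zero_right, enorm_cfc A y (hfc n), ← eLpNorm_neg]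
    refine (eLpNorm_congr_ae ?_).trans_le (eLpNorm_mono_measure _ (Measure.le_add_left le_rfl))
    have : ∀ᵐ t ∂(scalarSpectralMeasure A y), t ∉ S := by simpa [ae_iff] using hy
    filter_upwards [this] with t ht
    simp [ht]
  have h3 : Tendsto (fun n => ⟪cfc (f n) A x, y⟫_ℂ) atTop (𝓝 ⟪x, y⟫_ℂ) :=
    h1.inner tendsto_const_nhds
  have h4 : Tendsto (fun n => ⟪x, cfc (f n) A y⟫_ℂ) atTop (𝓝 ⟪x, 0⟫_ℂ) :=
    tendsto_const_nhds.inner h2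
  simp only [inner_cfc_left] at h3
  rw [inner_zero_right] at h4
  exact tendsto_nhds_unique h3 h4

theorem inner_eq_zero_of_disjoint (hA : IsSelfAdjoint A) (hS : MeasurableSet S)
    (hd : Disjoint S S') (hx : x ∈ spectralSubspace A S) (hy : y ∈ spectralSubspace A S') :
    ⟪x, y⟫_ℂ = 0 :=
  inner_eq_zero_of_mem_compl hA hS hx (spectralSubspace_mono hd.subset_compl_left hy)

theorem mem_spectralSubspace_compl_of_inner_eq_zero (hA : IsSelfAdjoint A) (hS : MeasurableSet S)
    (h : ∀ y ∈ spectralSubspace A S, ⟪y, x⟫_ℂ = 0) : x ∈ spectralSubspace A Sᶜ := by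
  obtain ⟨y, hy, z, hz, rfl, -⟩ := exists_spectral_decomposition hA hS x
  have h1 := h y hy
  rw [inner_add_right, inner_eq_zero_of_mem_compl hA hS hy hz, add_zero,
    inner_self_eq_zero] at h1
  rwa [h1, zero_add]

theorem spectralSubspace_cfc_mem (f : ℝ → ℝ) (hf : Continuous f) (hS : MeasurableSet S)
    (hx : x ∈ spectralSubspace A S) : cfc f A x ∈ spectralSubspace A S := by
  rw [mem_spectralSubspace, scalarSpectralMeasure_cfc_apply A x hf hS.compl,
    Measure.restrict_eq_zero.2 hx, lintegral_zero_measure]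

theorem spectralSubspace_apply_mem (hA : IsSelfAdjoint A) (hS : MeasurableSet S)
    (hx : x ∈ spectralSubspace A S) : A x ∈ spectralSubspace A S := by
  have := spectralSubspace_cfc_mem (fun t => t) continuous_id hS hx
  rwa [cfc_id' ℝ A] at this

theorem enorm_apply_sq (hA : IsSelfAdjoint A) (x : H) :
    ‖A x‖ₑ ^ 2 = ∫⁻ t, ‖t‖ₑ ^ 2 ∂(scalarSpectralMeasure A x) := by
  have := enorm_sq_cfc A x (f := fun t => t) continuous_id
  rwa [cfc_id' ℝ A] at this

theorem norm_apply_le_of_mem (hA : IsSelfAdjoint A) {b : ℝ} (hb : 0 ≤ b)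
    (hS : ∀ t ∈ spectrum ℝ A, t ∈ S → |t| ≤ b) (hx : x ∈ spectralSubspace A S) :
    ‖A x‖ ≤ b * ‖x‖ := by
  have h : ‖A x‖ₑ ^ 2 ≤ (ENNReal.ofReal b * ‖x‖ₑ) ^ 2 := by
    rw [enorm_apply_sq hA, mul_pow, ← scalarSpectralMeasure_univ hA, ← lintegral_const]
    refine lintegral_mono_ae ?_
    filter_upwards [ae_mem_spectrum A x, ae_mem_of_mem_spectralSubspace hx] with t h1 h2
    gcongr
    rw [← ofReal_norm]
    exact ENNReal.ofReal_le_ofReal (hS t h1 h2)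
  have h' := (ENNReal.pow_right_strictMono two_ne_zero).le_iff_le.1 h
  rwa [← ofReal_norm, ← ofReal_norm, ← ENNReal.ofReal_mul hb,
    ENNReal.ofReal_le_ofReal_iff (by positivity)] at h'

theorem le_norm_apply_of_mem (hA : IsSelfAdjoint A) {a : ℝ} (ha : 0 ≤ a)
    (hS : ∀ t ∈ spectrum ℝ A, t ∈ S → a ≤ |t|) (hx : x ∈ spectralSubspace A S) :
    a * ‖x‖ ≤ ‖A x‖ := by
  have h : (ENNReal.ofReal a * ‖x‖ₑ) ^ 2 ≤ ‖A x‖ₑ ^ 2 := by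
    rw [enorm_apply_sq hA, mul_pow, ← scalarSpectralMeasure_univ hA, ← lintegral_const]
    refine lintegral_mono_ae ?_
    filter_upwards [ae_mem_spectrum A x, ae_mem_of_mem_spectralSubspace hx] with t h1 h2
    gcongr
    rw [← ofReal_norm]
    exact ENNReal.ofReal_le_ofReal (hS t h1 h2)
  have h' := (ENNReal.pow_right_strictMono two_ne_zero).le_iff_le.1 h
  rwa [← ofReal_norm, ← ofReal_norm, ← ENNReal.ofReal_mul ha,
    ENNReal.ofReal_le_ofReal_iff (by positivity)] at h'

theorem mem_spectralSubspace_singleton_zero (hA : IsSelfAdjoint A) :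
    x ∈ spectralSubspace A {0} ↔ A x = 0 := by
  have h := enorm_apply_sq hA x
  have hm : Measurable fun t : ℝ => ‖t‖ₑ ^ 2 := by fun_prop
  have h2 : A x = 0 ↔ ‖A x‖ₑ ^ 2 = 0 := by simp
  rw [h2, h, lintegral_eq_zero_iff hm, mem_spectralSubspace]
  have : ({0}ᶜ : Set ℝ) = {t | ¬ (fun t : ℝ => ‖t‖ₑ ^ 2) t = (0 : ℝ → ENNReal) t} := by
    ext t
    simp
  rw [this]
  rfl

end SpectralSubspace

/-! ### Hilbert dimension -/

section HilbertDim

open Cardinal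

/-- The range of `L` need not be closed, so no basis is transported. If `κ` is finite, linear
independence suffices. If `κ` is infinite, each `L (b i)` has a nonzero coefficient at some `d k`,
and each `k` serves only countably many `i`. -/
theorem HilbertBasis.mk_le_mk_of_injective {X Y : Type*} [NormedAddCommGroup X]
    [InnerProductSpace ℂ X] [NormedAddCommGroup Y] [InnerProductSpace ℂ Y]
    [CompleteSpace X] [CompleteSpace Y] {ι κ : Type u} (b : HilbertBasis ι ℂ X)
    (d : HilbertBasis κ ℂ Y) (L : X →L[ℂ] Y) (hL : Function.Injective L) : #ι ≤ #κ := by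
  cases finite_or_infinite κ with
  | inl h =>
    have := Fintype.ofFinite κ
    have hfd : FiniteDimensional ℂ Y := d.toOrthonormalBasis.toBasis.finiteDimensional_of_finite
    have hli : LinearIndependent ℂ fun i => L (b i) :=
      b.orthonormal.linearIndependent.map' L.toLinearMap (LinearMap.ker_eq_bot.2 hL)
    have := hli.finite
    have := Fintype.ofFinite ι
    have h1 := hli.fintype_card_le_finrank
    rw [Module.finrank_eq_card_basis d.toOrthonormalBasis.toBasis] at h1
    simpa using h1
  | inr h =>
    have hex : ∀ i, ∃ k, ⟪d k, L (b i)⟫_ℂ ≠ 0 := fun i => by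
      by_contra! hc
      have h0 : L (b i) = 0 := by
        apply d.repr.injective
        ext k
        rw [d.repr_apply_apply, hc k]
        simp
      have h1 : b i = 0 := hL (by rw [h0, map_zero])
      simpa [h1] using b.orthonormal.1 i
    choose k hk using hex
    have hcount : ∀ j, (k ⁻¹' {j}).Countable := fun j => by
      -- Bessel's inequality for `L* (d j)`: only countably many of its coefficients are nonzero.
      have hs := b.orthonormal.inner_products_summable (x := ContinuousLinearMap.adjoint L (d j))
      refine hs.countable_support.mono fun i hi => ?_
      have hki : k i = j := hi
      have := hk i
      rw [hki, ← ContinuousLinearMap.adjoint_inner_left] at this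
      rw [Function.mem_support, norm_inner_symm]
      simpa using this
    by_contra! hlt
    have : Uncountable ι := by
      rw [← aleph0_lt_mk_iff]
      exact (aleph0_le_mk κ).trans_lt hlt
    obtain ⟨j, hj⟩ := exists_uncountable_fiber k hlt
    exact hj.1 (hcount j)

variable {H : Type u} [NormedAddCommGroup H] [InnerProductSpace ℂ H] [CompleteSpace H]
  {H' : Type u} [NormedAddCommGroup H'] [InnerProductSpace ℂ H'] [CompleteSpace H']

theorem hilbertDim_eq_mk {ι : Type u} (b : HilbertBasis ι ℂ H) : hilbertDim H = #ι := by
  refine le_antisymm (csInf_le' ⟨ι, b, rfl⟩) (le_csInf ⟨_, ι, b, rfl⟩ ?_)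
  rintro _ ⟨κ, d, rfl⟩
  exact b.mk_le_mk_of_injective d (.id ℂ H) Function.injective_id

theorem hilbertDim_le_of_injective (L : H →L[ℂ] H') (hL : Function.Injective L) :
    hilbertDim H ≤ hilbertDim H' := by
  obtain ⟨w, b, -⟩ := exists_hilbertBasis ℂ H
  obtain ⟨w', b', -⟩ := exists_hilbertBasis ℂ H'
  rw [hilbertDim_eq_mk b, hilbertDim_eq_mk b']
  exact b.mk_le_mk_of_injective b' L hL

/-- The Hilbert basis with the index type replaced by an equivalent one. -/
noncomputable def HilbertBasis.reindex {X ι κ : Type*} [NormedAddCommGroup X]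
    [InnerProductSpace ℂ X] [CompleteSpace X] (b : HilbertBasis ι ℂ X) (e : κ ≃ ι) : HilbertBasis κ ℂ X :=
  HilbertBasis.mk (b.orthonormal.comp e e.injective) (by
    rw [e.surjective.range_comp, b.dense_span])

theorem HilbertBasis.reindex_apply {X ι κ : Type*} [NormedAddCommGroup X] [InnerProductSpace ℂ X]
    [CompleteSpace X] (b : HilbertBasis ι ℂ X) (e : κ ≃ ι) (k : κ) : b.reindex e k = b (e k) := by
  simp [HilbertBasis.reindex]

theorem exists_hilbertBasis_of_mk_eq {ι : Type u} (h : #ι = hilbertDim H) :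
    Nonempty (HilbertBasis ι ℂ H) := by
  obtain ⟨w, b, -⟩ := exists_hilbertBasis ℂ H
  rw [hilbertDim_eq_mk b] at h
  obtain ⟨e⟩ := Cardinal.eq.1 h
  exact ⟨b.reindex e⟩

/-- Hilbert bases of pairwise orthogonal subspaces with dense span give a Hilbert basis. -/
theorem exists_hilbertBasis_sigma {X ι : Type*} {κ : ι → Type*} {G : ι → Type*}
    [NormedAddCommGroup X] [InnerProductSpace ℂ X] [CompleteSpace X]
    [∀ i, NormedAddCommGroup (G i)] [∀ i, InnerProductSpace ℂ (G i)]
    {V : ∀ i, G i →ₗᵢ[ℂ] X} (hV : OrthogonalFamily ℂ G V) (b : ∀ i, HilbertBasis (κ i) ℂ (G i))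
    (htot : ∀ x, (∀ i (g : G i), ⟪V i g, x⟫_ℂ = 0) → x = 0) :
    ∃ d : HilbertBasis (Σ i, κ i) ℂ X, ∀ i k, d ⟨i, k⟩ = V i (b i k) := by
  have ho : Orthonormal ℂ fun a : Σ i, κ i => V a.1 (b a.1 a.2) :=
    hV.orthonormal_sigma_orthonormal fun i => (b i).orthonormal
  refine ⟨HilbertBasis.mkOfOrthogonalEqBot ho ?_, fun i k => by
    rw [HilbertBasis.coe_mkOfOrthogonalEqBot]⟩
  rw [Submodule.eq_bot_iff]
  intro x hx
  refine htot x fun i => ?_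
  have hx' : ∀ k, ⟪V i (b i k), x⟫_ℂ = 0 := fun k =>
    (Submodule.mem_orthogonal _ _).1 hx _ (Submodule.subset_span ⟨⟨i, k⟩, rfl⟩)
  have hcl : IsClosed {g : G i | ⟪V i g, x⟫_ℂ = 0} :=
    isClosed_eq (by fun_prop) continuous_const
  have hsub : (Submodule.span ℂ (Set.range (b i)) : Set (G i)) ⊆ {g : G i | ⟪V i g, x⟫_ℂ = 0} := by
    intro g hg
    induction hg using Submodule.span_induction with
    | mem g hg =>
      obtain ⟨k, rfl⟩ := hg
      exact hx' k
    | zero => simp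
    | add g g' _ _ h h' =>
      simp only [Set.mem_ofPred_eq] at h h' ⊢
      rw [map_add, inner_add_left, h, h', add_zero]
    | smul c g _ h =>
      simp only [Set.mem_ofPred_eq] at h ⊢
      rw [map_smul, inner_smul_left, h, mul_zero]
  intro g
  have hg : g ∈ (Submodule.span ℂ (Set.range (b i))).topologicalClosure := by
    rw [(b i).dense_span]
    trivial
  exact closure_minimal hsub hcl hg

end HilbertDim

/-! ### The dimension spectral measure is a cardinal-valued measure -/

section DimSpectralMeasure

variable {H : Type u} [NormedAddCommGroup H] [InnerProductSpace ℂ H] [CompleteSpace H]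
  {A : H →L[ℂ] H}

theorem completeSpace_spectralSubspace (hA : IsSelfAdjoint A) (S : Set ℝ) :
    CompleteSpace (spectralSubspace A S) :=
  (isClosed_spectralSubspace hA S).completeSpace_coe

/-- Orthogonality to each piece makes the scalar measure of `x` vanish on each piece, hence on the
union by countable subadditivity. -/
theorem eq_zero_of_mem_spectralSubspace_iUnion {α : Type*} [Countable α] (hA : IsSelfAdjoint A)
    {S : α → Set ℝ}
    (hS : ∀ n, MeasurableSet (S n)) {x : H} (hx : x ∈ spectralSubspace A (⋃ n, S n))
    (h : ∀ n, ∀ y ∈ spectralSubspace A (S n), ⟪y, x⟫_ℂ = 0) : x = 0 := by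
  have h1 : ∀ n, scalarSpectralMeasure A x (S n) = 0 := fun n =>
    mem_spectralSubspace_compl.1 (mem_spectralSubspace_compl_of_inner_eq_zero hA (hS n) (h n))
  refine eq_zero_of_scalarSpectralMeasure_eq_zero hA (Measure.measure_univ_eq_zero.1 ?_)
  rw [← Set.union_compl_self (⋃ n, S n)]
  exact measure_union_null (measure_iUnion_null h1) hx

/-- Hilbert bases of the spectral subspaces of a countable partition give a Hilbert basis. -/
theorem exists_hilbertBasis_spectralSubspace_iUnion {α : Type*} [Countable α]
    {κ : α → Type*} (hA : IsSelfAdjoint A) {S : α → Set ℝ} (hS : ∀ n, MeasurableSet (S n))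
    (hd : Pairwise (Function.onFun Disjoint S))
    (b : ∀ n, HilbertBasis (κ n) ℂ (spectralSubspace A (S n))) :
    ∃ d : HilbertBasis (Σ n, κ n) ℂ (spectralSubspace A (⋃ n, S n)),
      ∀ n k, (d ⟨n, k⟩ : H) = b n k := by
  have := completeSpace_spectralSubspace hA (⋃ n, S n)
  let V : ∀ n, spectralSubspace A (S n) →ₗᵢ[ℂ] spectralSubspace A (⋃ n, S n) := fun n =>
    ⟨Submodule.inclusion (spectralSubspace_mono (Set.subset_iUnion S n)), fun _ => rfl⟩
  have hV : OrthogonalFamily ℂ (fun n => spectralSubspace A (S n)) V := fun i j hij x y => by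
    have h : ⟪(x : H), (y : H)⟫_ℂ = 0 := inner_eq_zero_of_disjoint hA (hS i) (hd hij) x.2 y.2
    exact h
  obtain ⟨d, hd⟩ := exists_hilbertBasis_sigma hV b fun x hx => Subtype.ext
    (eq_zero_of_mem_spectralSubspace_iUnion hA hS x.2 fun n y hy => hx n ⟨y, hy⟩)
  exact ⟨d, fun n k => congrArg Subtype.val (hd n k)⟩

variable {K : Type v} [NormedAddCommGroup K] [InnerProductSpace ℂ K] [CompleteSpace K]

theorem adjoint_comp_self_nonneg (T : H →L[ℂ] K) : 0 ≤ ContinuousLinearMap.adjoint T ∘L T := by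
  rw [ContinuousLinearMap.nonneg_iff_isPositive]
  exact ContinuousLinearMap.isPositive_adjoint_comp_self T

theorem absOp_nonneg (T : H →L[ℂ] K) : 0 ≤ absOp T := CFC.sqrt_nonneg _

theorem isSelfAdjoint_absOp (T : H →L[ℂ] K) : IsSelfAdjoint (absOp T) :=
  IsSelfAdjoint.of_nonneg (absOp_nonneg T)

theorem nonneg_of_mem_spectrum_absOp (T : H →L[ℂ] K) {t : ℝ} (ht : t ∈ spectrum ℝ (absOp T)) :
    0 ≤ t := spectrum_nonneg_of_nonneg (absOp_nonneg T) ht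

theorem absOp_absOp (T : H →L[ℂ] K) (x : H) :
    absOp T (absOp T x) = ContinuousLinearMap.adjoint T (T x) := by
  have h : absOp T * absOp T = ContinuousLinearMap.adjoint T ∘L T :=
    CFC.sqrt_mul_sqrt_self _ (adjoint_comp_self_nonneg T)
  exact congrArg (fun B : H →L[ℂ] H => B x) h

theorem inner_absOp (T : H →L[ℂ] K) (x y : H) : ⟪absOp T x, absOp T y⟫_ℂ = ⟪T x, T y⟫_ℂ := by
  rw [← ContinuousLinearMap.adjoint_inner_right T, ← absOp_absOp]
  exact (isSelfAdjoint_absOp T).isSymmetric x _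

theorem norm_absOp (T : H →L[ℂ] K) (x : H) : ‖absOp T x‖ = ‖T x‖ := by
  rw [@norm_eq_sqrt_re_inner ℂ, @norm_eq_sqrt_re_inner ℂ, inner_absOp]

theorem measurableSet_coe_image {S : Set ℝ≥0} (hS : MeasurableSet S) :
    MeasurableSet ((fun t : ℝ≥0 => (t : ℝ)) '' S) :=
  (MeasurableEmbedding.subtype_coe measurableSet_Ici).measurableSet_image.2 hS

theorem dimSpectralMeasure_iUnion (T : H →L[ℂ] K) {α : Type} [Countable α] (S : α → Set ℝ≥0)
    (hS : ∀ n, MeasurableSet (S n)) (hd : Pairwise (Function.onFun Disjoint S)) :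
    dimSpectralMeasure T (⋃ n, S n) = Cardinal.sum fun n => dimSpectralMeasure T (S n) := by
  have hA := isSelfAdjoint_absOp T
  have hc := fun n => completeSpace_spectralSubspace hA ((fun t : ℝ≥0 => (t : ℝ)) '' S n)
  have := completeSpace_spectralSubspace hA (⋃ n, (fun t : ℝ≥0 => (t : ℝ)) '' S n)
  choose w b hb using fun n =>
    exists_hilbertBasis ℂ (spectralSubspace (absOp T) ((fun t : ℝ≥0 => (t : ℝ)) '' S n))
  obtain ⟨d, -⟩ := exists_hilbertBasis_spectralSubspace_iUnion hA
    (fun n => measurableSet_coe_image (hS n))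
    (fun i j hij => (Set.disjoint_image_iff NNReal.coe_injective).2 (hd hij)) b
  simp only [dimSpectralMeasure]
  rw [Set.image_iUnion, hilbertDim_eq_mk d, Cardinal.mk_sigma]
  congr 1
  ext n
  rw [hilbertDim_eq_mk (b n)]

theorem isCardinalMeasure_dimSpectralMeasure (T : H →L[ℂ] K) :
    IsCardinalMeasure (dimSpectralMeasure T) := by
  refine ⟨?_, fun S hS hd => dimSpectralMeasure_iUnion T S hS hd⟩
  have := dimSpectralMeasure_iUnion T (α := Empty) (fun _ => ∅) (fun n => n.elim) fun i => i.elim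
  rw [Set.iUnion_of_empty] at this
  rw [this]
  simp

theorem hilbertDim_eq_zero_of_subsingleton {X : Type u} [NormedAddCommGroup X]
    [InnerProductSpace ℂ X] [CompleteSpace X] [Subsingleton X] : hilbertDim X = 0 := by
  obtain ⟨w, b, -⟩ := exists_hilbertBasis ℂ X
  rw [hilbertDim_eq_mk b, Cardinal.mk_eq_zero_iff]
  refine ⟨fun i => ?_⟩
  have h := b.orthonormal.1 i
  rw [Subsingleton.elim (b i) 0, norm_zero] at h
  exact zero_ne_one h

theorem nnreal_le_nnnorm_of_mem_spectrum {r : ℝ≥0} (h : (r : ℝ) ∈ spectrum ℝ A) : r ≤ ‖A‖₊ := by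
  have h1 : ‖(r : ℝ)‖ ≤ ‖A‖ * ‖(1 : H →L[ℂ] H)‖ := spectrum.norm_le_norm_mul_of_mem h
  have h2 : ‖(r : ℝ)‖ ≤ ‖A‖ * 1 := h1.trans (by
    gcongr
    exact ContinuousLinearMap.norm_id_le)
  rw [mul_one, Real.norm_eq_abs, NNReal.abs_eq] at h2
  exact h2

theorem dimSpectralMeasure_eq_zero_of_norm_lt (T : H →L[ℂ] K) {S : Set ℝ≥0}
    (hS : ∀ t ∈ S, ‖absOp T‖₊ < t) : dimSpectralMeasure T S = 0 := by
  have hA := isSelfAdjoint_absOp T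
  have hc := completeSpace_spectralSubspace hA ((fun t : ℝ≥0 => (t : ℝ)) '' S)
  have : Subsingleton (spectralSubspace (absOp T) ((fun t : ℝ≥0 => (t : ℝ)) '' S)) := by
    refine subsingleton_of_forall_eq 0 fun x => Subtype.ext ?_
    refine eq_zero_of_scalarSpectralMeasure_eq_zero hA (Measure.measure_univ_eq_zero.1 ?_)
    have hf : ∀ᵐ t ∂(scalarSpectralMeasure (absOp T) (x : H)), False := by
      filter_upwards [ae_mem_spectrum (absOp T) (x : H), ae_mem_of_mem_spectralSubspace x.2]
        with t h1 h2
      obtain ⟨r, hr, rfl⟩ := h2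
      exact absurd (hS r hr) (nnreal_le_nnnorm_of_mem_spectrum h1).not_gt
    rw [ae_iff] at hf
    simpa using hf
  exact hilbertDim_eq_zero_of_subsingleton

end DimSpectralMeasure

/-! ### Finite additivity and monotonicity of cardinal-valued measures -/

section CardinalMeasure

open Cardinal

variable {α : Type*} [MeasurableSpace α] {m : Set α → Cardinal.{u}} {S S' : Set α}

theorem IsCardinalMeasure.union (h : IsCardinalMeasure m) (hS : MeasurableSet S)
    (hS' : MeasurableSet S') (hd : Disjoint S S') : m (S ∪ S') = m S + m S' := by
  let U : ℕ → Set α := fun n => if n = 0 then S else if n = 1 then S' else ∅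
  have hU : ⋃ n, U n = S ∪ S' := by
    ext x
    simp only [Set.mem_iUnion, Set.mem_union]
    constructor
    · rintro ⟨n, hn⟩
      simp only [U] at hn
      split_ifs at hn
      · exact Or.inl hn
      · exact Or.inr hn
      · exact hn.elim
    · rintro (hx | hx)
      · exact ⟨0, by simpa [U] using hx⟩
      · exact ⟨1, by simpa [U] using hx⟩
  have hm : ∀ n, MeasurableSet (U n) := fun n => by
    simp only [U]
    split_ifs
    exacts [hS, hS', MeasurableSet.empty]
  have hdU : Pairwise (Function.onFun Disjoint U) := fun i j hij => by
    simp only [Function.onFun, U]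
    split_ifs <;> first | omega | simp [hd.symm]
  rw [← hU, h.iUnion U hm hdU]
  rw [sum_nat_eq_add_sum_succ, sum_nat_eq_add_sum_succ]
  simp [U, h.empty]

theorem IsCardinalMeasure.mono (h : IsCardinalMeasure m) (hS : MeasurableSet S)
    (hS' : MeasurableSet S') (hss : S ⊆ S') : m S ≤ m S' := by
  rw [← Set.union_sdiff_cancel hss, h.union hS (hS'.diff hS) Set.disjoint_sdiff_right]
  exact self_le_add_right _ _

theorem IsCardinalMeasure.union_le (h : IsCardinalMeasure m) (hS : MeasurableSet S)
    (hS' : MeasurableSet S') : m (S ∪ S') ≤ m S + m S' := by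
  rw [← Set.union_sdiff_self, h.union hS (hS'.diff hS) Set.disjoint_sdiff_right]
  gcongr
  exact h.mono (hS'.diff hS) hS' Set.sdiff_subset

end CardinalMeasure

/-! ### The interval condition and its relation to shifts -/

section SpreadsInto

open Cardinal

/-- The mass of every interval is at most the mass of its enlargement by the log-distance
`log C`. -/
def SpreadsInto (C : ℝ≥0) (m m' : Set ℝ≥0 → Cardinal.{u}) : Prop :=
  ∀ a b, m (Set.Icc a b) ≤ m' (Set.Icc (a / C) (C * b))

theorem SpreadsInto.trans {C D : ℝ≥0} {m m' m'' : Set ℝ≥0 → Cardinal.{u}}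
    (h : SpreadsInto C m m') (h' : SpreadsInto D m' m'') : SpreadsInto (D * C) m m'' := by
  intro a b
  have := (h a b).trans (h' _ _)
  rwa [div_div, mul_comm C D, ← mul_assoc] at this

/-- Each of two measures spreads into the other one, with a constant `C > 1`. -/
def MutuallySpread (m m' : Set ℝ≥0 → Cardinal.{u}) : Prop :=
  ∃ C : ℝ≥0, 1 < C ∧ SpreadsInto C m m' ∧ SpreadsInto C m' m

theorem MutuallySpread.symm {m m' : Set ℝ≥0 → Cardinal.{u}} (h : MutuallySpread m m') :
    MutuallySpread m' m := by
  obtain ⟨C, hC, h1, h2⟩ := h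
  exact ⟨C, hC, h2, h1⟩

theorem MutuallySpread.trans {m m' m'' : Set ℝ≥0 → Cardinal.{u}} (h : MutuallySpread m m')
    (h' : MutuallySpread m' m'') : MutuallySpread m m'' := by
  obtain ⟨C, hC, h1, h2⟩ := h
  obtain ⟨D, hD, h1', h2'⟩ := h'
  refine ⟨D * C, one_lt_mul'' hD hC, h1.trans h1', ?_⟩
  rw [mul_comm]
  exact h2'.trans h2

theorem logClose_iff_mem_Icc {C x y : ℝ≥0} (hC : 0 < C) :
    LogClose C x y ↔ y ∈ Set.Icc (x / C) (C * x) := by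
  rw [LogClose, Set.mem_Icc, div_le_iff₀' hC]

theorem LogClose.symm {C x y : ℝ≥0} (h : LogClose C x y) : LogClose C y x := ⟨h.2, h.1⟩

theorem LogClose.mem_Icc {C x y a b : ℝ≥0} (hC : 0 < C) (h : LogClose C x y)
    (hx : x ∈ Set.Icc a b) : y ∈ Set.Icc (a / C) (C * b) := by
  rw [logClose_iff_mem_Icc hC] at h
  refine ⟨le_trans ?_ h.1, h.2.trans ?_⟩
  · exact div_le_div_of_nonneg_right hx.1 hC.le
  · exact mul_le_mul_right hx.2 C

theorem measurableSet_not_logClose (C : ℝ≥0) :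
    MeasurableSet {p : ℝ≥0 × ℝ≥0 | ¬ LogClose C p.1 p.2} := by
  refine MeasurableSet.compl (IsClosed.measurableSet ?_)
  exact (isClosed_le (by fun_prop) (by fun_prop)).inter
    (isClosed_le (by fun_prop) (by fun_prop))

theorem LogBoundedShift.mutuallySpread {m m' : Set ℝ≥0 → Cardinal.{u}}
    (h : LogBoundedShift m m') : MutuallySpread m m' := by
  obtain ⟨C, P, hC, hP, h1, h2, h0⟩ := h
  have hC0 : 0 < C := zero_lt_one.trans hC
  -- Pairs that are not log-close carry no mass, so inclusions need only be checked on log-close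
  -- pairs.
  have key : ∀ S S' : Set (ℝ≥0 × ℝ≥0), MeasurableSet S → MeasurableSet S' →
      (∀ p ∈ S, LogClose C p.1 p.2 → p ∈ S') → P S ≤ P S' := by
    intro S S' hS hS' hss
    have hb := measurableSet_not_logClose C
    calc P S ≤ P (S' ∪ {p | ¬ LogClose C p.1 p.2}) :=
          hP.mono hS (hS'.union hb) fun p hp => by
            by_cases hc : LogClose C p.1 p.2
            exacts [Or.inl (hss p hp hc), Or.inr hc]
      _ ≤ P S' + 0 := h0 ▸ hP.union_le hS' hb
      _ = P S' := add_zero _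
  refine ⟨C, hC, fun a b => ?_, fun a b => ?_⟩
  · rw [← h1 _ measurableSet_Icc, ← h2 _ measurableSet_Icc]
    exact key _ _ (measurableSet_Icc.prod .univ) (MeasurableSet.univ.prod measurableSet_Icc)
      fun p hp hc => ⟨trivial, hc.mem_Icc hC0 hp.1⟩
  · rw [← h1 _ measurableSet_Icc, ← h2 _ measurableSet_Icc]
    exact key _ _ (MeasurableSet.univ.prod measurableSet_Icc) (measurableSet_Icc.prod .univ)
      fun p hp hc => ⟨hc.symm.mem_Icc hC0 hp.2, trivial⟩

end SpreadsInto

/-! ### Matching units of mass -/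

section Transfer

open Cardinal

theorem exists_injective_sigma_of_fibers {X : Type u} {β : Type} {F : β → Type u} (l : X → β)
    (h : ∀ b, #{x // l x = b} ≤ #(F b)) :
    ∃ f : X → Σ b, F b, Function.Injective f ∧ ∀ x, (f x).1 = l x := by
  have g : ∀ b, {x // l x = b} ↪ F b := fun b => Classical.choice ((Cardinal.le_def _ _).1 (h b))
  refine ⟨fun x => ⟨l x, g (l x) ⟨x, rfl⟩⟩, fun x y hxy => ?_, fun _ => rfl⟩
  have key : ∀ b b' (x : {x // l x = b}) (y : {x // l x = b'}),
      (⟨b, g b x⟩ : Σ b, F b) = ⟨b', g b' y⟩ → (x : X) = y := by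
    rintro b b' x y h
    obtain rfl : b = b' := congrArg Sigma.fst h
    rw [Sigma.mk.injEq] at h
    exact congrArg Subtype.val ((g b).injective (eq_of_heq h.2))
  exact key _ _ ⟨x, rfl⟩ ⟨y, rfl⟩ hxy

variable {α β : Type} {E : α → Type u} {F : β → Type u} {p : α → ℝ≥0} {q : β → ℝ≥0} {C : ℝ≥0}

/-- Countably many sets of size at most `#(F b)` fit together into `F b` when it is infinite. -/
theorem exists_injective_of_mk_le [Countable α] {good : Set α} (l : good → β)
    (hinf : ∀ a, Infinite (F (l a))) (hle : ∀ a : good, #(E a) ≤ #(F (l a))) :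
    ∃ f : (Σ a : good, E a) → Σ b, F b, Function.Injective f ∧ ∀ x, (f x).1 = l x.1 := by
  refine exists_injective_sigma_of_fibers (fun x : Σ a : good, E a => l x.1) fun b => ?_
  have h1 : #{x : Σ a : good, E a // l x.1 = b} ≤ #(Σ a : {a : good // l a = b}, E a) := by
    refine mk_le_of_injective (f := fun x => ⟨⟨x.1.1, x.2⟩, x.1.2⟩) ?_
    rintro ⟨⟨a, e⟩, h⟩ ⟨⟨a', e'⟩, h'⟩ heq
    simp only [Sigma.mk.injEq, Subtype.mk.injEq] at heq
    obtain ⟨rfl, heq⟩ := heq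
    cases heq
    rfl
  refine h1.trans ?_
  rcases isEmpty_or_nonempty {a : good // l a = b} with he | ⟨⟨a, ha⟩⟩
  · rw [mk_eq_zero]
    exact zero_le
  rw [mk_sigma]
  have := hinf a
  rw [ha] at this
  calc Cardinal.sum (fun a : {a : good // l a = b} => #(E a))
      ≤ Cardinal.sum (fun _ : {a : good // l a = b} => #(F b)) :=
        sum_le_sum _ _ fun a => by
          have := hle a
          rwa [a.2] at this
    _ ≤ ℵ₀ * #(F b) := by
        rw [sum_const]
        gcongr
        · simp
        · simp
    _ = #(F b) := aleph0_mul_eq (aleph0_le_mk _)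

/-- Hall's condition. If `s` reaches everything in the enlargement of its hull, the interval
hypothesis is the claim. Otherwise an unreached `y` there cuts `s` into two smaller sets whose
neighbours lie strictly on opposite sides of `q y.1`, and the counts add. -/
theorem card_le_card_biUnion_of_spreads [DecidableEq (Σ b, F b)] {X : Type u} (r : X → ℝ≥0)
    (hC : 0 < C) (t : X → Finset (Σ b, F b))
    (ht : ∀ x y, y ∈ t x ↔ LogClose C (r x) (q y.1))
    (h : ∀ a b, #{x | r x ∈ Set.Icc a b} ≤
      #{y : Σ b, F b | q y.1 ∈ Set.Icc (a / C) (C * b)}) (s : Finset X) :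
    s.card ≤ (s.biUnion t).card := by
  induction s using Finset.strongInduction with
  | H s ih =>
    rcases s.eq_empty_or_nonempty with rfl | hs
    · simp
    obtain ⟨x₀, hx₀, hmin⟩ := s.exists_min_image r hs
    obtain ⟨x₁, hx₁, hmax⟩ := s.exists_max_image r hs
    by_cases hall : ∀ y : Σ b, F b, q y.1 ∈ Set.Icc (r x₀ / C) (C * r x₁) → y ∈ s.biUnion t
    · have h1 : #s ≤ #(s.biUnion t : Finset _) := by
        refine le_trans ?_ ((h (r x₀) (r x₁)).trans ?_)
        · exact mk_le_mk_of_subset (s := (s : Set X)) fun x hx => ⟨hmin x hx, hmax x hx⟩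
        · exact mk_le_mk_of_subset (t := (s.biUnion t : Set (Σ b, F b))) hall
      rw [mk_coe_finset, mk_coe_finset] at h1
      exact_mod_cast h1
    · push Not at hall
      obtain ⟨y, hy, hyt⟩ := hall
      have hyx : ∀ x ∈ s, ¬ LogClose C (r x) (q y.1) := fun x hx hc =>
        hyt (Finset.mem_biUnion.2 ⟨x, hx, (ht x y).2 hc⟩)
      have hy0 : r x₀ ≤ C * q y.1 := (div_le_iff₀' hC).1 hy.1
      set s₁ := s.filter fun x => C * q y.1 < r x with hs₁
      set s₂ := s.filter fun x => ¬ C * q y.1 < r x with hs₂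
      have h2 : ∀ x ∈ s₂, C * r x < q y.1 := fun x hx => by
        rw [hs₂, Finset.mem_filter] at hx
        have := hyx x hx.1
        by_contra hc
        exact this ⟨not_lt.1 hx.2, not_lt.1 hc⟩
      have hss₁ : s₁ ⊂ s := Finset.filter_ssubset.2 ⟨x₀, hx₀, not_lt.2 hy0⟩
      have hss₂ : s₂ ⊂ s := by
        refine Finset.ssubset_iff_subset_ne.2 ⟨Finset.filter_subset _ _, fun he => ?_⟩
        exact absurd (h2 x₁ (he ▸ hx₁)) (not_lt.2 hy.2)
      have hd : Disjoint (s₁.biUnion t) (s₂.biUnion t) := by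
        rw [Finset.disjoint_left]
        intro z hz1 hz2
        obtain ⟨x, hx, hzx⟩ := Finset.mem_biUnion.1 hz1
        obtain ⟨x', hx', hzx'⟩ := Finset.mem_biUnion.1 hz2
        have h3 : C * q y.1 < C * q z.1 :=
          (Finset.mem_filter.1 hx).2.trans_le ((ht _ _).1 hzx).1
        have h4 : q z.1 < q y.1 := ((ht _ _).1 hzx').2.trans_lt (h2 x' hx')
        exact absurd (lt_of_mul_lt_mul_left' h3) h4.not_gt
      calc s.card = s₁.card + s₂.card := (Finset.card_filter_add_card_filter_not _).symm
        _ ≤ (s₁.biUnion t).card + (s₂.biUnion t).card := add_le_add (ih _ hss₁) (ih _ hss₂)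
        _ = (s₁.biUnion t ∪ s₂.biUnion t).card := (Finset.card_union_of_disjoint hd).symm
        _ ≤ (s.biUnion t).card := Finset.card_le_card (Finset.union_subset
            (Finset.biUnion_subset_biUnion_of_subset_left _ hss₁.1)
            (Finset.biUnion_subset_biUnion_of_subset_left _ hss₂.1))

/-- Points that have a large enough infinite weight in reach are absorbed by it. Any other point has
only finite weights in reach, so Hall's theorem applies. The two images lie over infinite and finite
weights respectively, hence are disjoint. -/
theorem exists_injective_logClose [Countable α] (hC : 0 < C)
    (hfin : ∀ a, {b | LogClose C (p a) (q b)}.Finite)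
    (h : ∀ a b, #{x : Σ a, E a | p x.1 ∈ Set.Icc a b} ≤
      #{y : Σ b, F b | q y.1 ∈ Set.Icc (a / C) (C * b)}) :
    ∃ f : (Σ a, E a) → Σ b, F b, Function.Injective f ∧ ∀ x, LogClose C (p x.1) (q (f x).1) := by
  classical
  set bad : Set α := {a | ∃ b, LogClose C (p a) (q b) ∧ Infinite (F b) ∧ #(E a) ≤ #(F b)}
    with hbad
  -- If some weight in reach is infinite, the largest of the finitely many in reach equals their sum
  -- up to a factor `ℵ₀`, so it bounds `#(E a)` by the interval condition on `[p a, p a]`.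
  have hgood : ∀ a ∉ bad, ∀ b, LogClose C (p a) (q b) → Finite (F b) := by
    intro a ha b₀ hb₀
    by_contra hinf
    rw [not_finite_iff_infinite] at hinf
    obtain ⟨b, hb, hmax⟩ := Set.exists_max_image _ (fun b => #(F b)) (hfin a) ⟨b₀, hb₀⟩
    have hle : ℵ₀ ≤ #(F b) := (aleph0_le_mk (F b₀)).trans (hmax b₀ hb₀)
    refine ha ⟨b, hb, infinite_iff.2 hle, ?_⟩
    have := (hfin a).to_subtype
    calc #(E a) ≤ #{x : Σ a, E a | p x.1 ∈ Set.Icc (p a) (p a)} :=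
          mk_le_of_injective (f := fun e => ⟨⟨a, e⟩, by simp⟩) fun e e' hee => by simpa using hee
      _ ≤ _ := h _ _
      _ ≤ #(Σ b : {b | LogClose C (p a) (q b)}, F b) := by
          refine mk_le_of_injective
            (f := fun y => ⟨⟨y.1.1, (logClose_iff_mem_Icc hC).2 y.2⟩, y.1.2⟩) ?_
          rintro ⟨⟨b, e⟩, h⟩ ⟨⟨b', e'⟩, h'⟩ heq
          simp only [Sigma.mk.injEq, Subtype.mk.injEq] at heq
          obtain ⟨rfl, heq⟩ := heq
          cases heq
          rfl
      _ ≤ Cardinal.sum (fun _ : {b | LogClose C (p a) (q b)} => #(F b)) := by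
          rw [mk_sigma]
          exact sum_le_sum _ _ fun b => hmax b b.2
      _ ≤ ℵ₀ * #(F b) := by
          rw [sum_const]
          gcongr
          · simp
          · simp
      _ = #(F b) := aleph0_mul_eq hle
  choose l hl using fun a : bad => a.2
  obtain ⟨f₁, hf₁, hf₁l⟩ := exists_injective_of_mk_le (E := E) (F := F) l (fun a => (hl a).2.1)
    fun a => (hl a).2.2
  have hfinset : ∀ x : Σ a : (badᶜ : Set α), E a,
      {y : Σ b, F b | LogClose C (p x.1) (q y.1)}.Finite := fun x => by
    have := (hfin x.1).to_subtype
    have : ∀ b : {b | LogClose C (p x.1) (q b)}, Finite (F b) := fun b => hgood _ x.1.2 b b.2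
    refine (Set.finite_range fun z : Σ b : {b | LogClose C (p x.1) (q b)}, F b =>
      (⟨z.1, z.2⟩ : Σ b, F b)).subset ?_
    rintro ⟨b, e⟩ hb
    exact ⟨⟨⟨b, hb⟩, e⟩, rfl⟩
  obtain ⟨f₂, hf₂, hf₂t⟩ := (Finset.all_card_le_biUnion_card_iff_exists_injective
    (fun x => (hfinset x).toFinset)).1 (card_le_card_biUnion_of_spreads (q := q)
      (fun x : Σ a : (badᶜ : Set α), E a => p x.1) hC _ (fun x y => by simp) fun a b => by
        refine le_trans ?_ (h a b)
        refine mk_le_of_injective (f := fun x => ⟨⟨x.1.1, x.1.2⟩, x.2⟩) ?_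
        rintro ⟨⟨⟨a, ha⟩, e⟩, h⟩ ⟨⟨⟨a', ha'⟩, e'⟩, h'⟩ heq
        simp only [Sigma.mk.injEq, Subtype.mk.injEq] at heq
        obtain ⟨rfl, heq⟩ := heq
        cases heq
        rfl)
  have hf₂t' : ∀ x, LogClose C (p x.1) (q (f₂ x).1) := fun x => by simpa using hf₂t x
  have hne : ∀ x y, f₁ x ≠ f₂ y := fun x y hxy => by
    have h1 : Infinite (F (f₁ x).1) := by
      rw [hf₁l]
      exact (hl _).2.1
    have h2 : Finite (F (f₂ y).1) := hgood _ y.1.2 _ (hf₂t' y)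
    rw [hxy] at h1
    exact not_finite (F (f₂ y).1)
  refine ⟨fun x => if hx : x.1 ∈ bad then f₁ ⟨⟨x.1, hx⟩, x.2⟩ else f₂ ⟨⟨x.1, hx⟩, x.2⟩, ?_, ?_⟩
  · rintro ⟨a, e⟩ ⟨a', e'⟩ hxy
    by_cases ha : a ∈ bad <;> by_cases ha' : a' ∈ bad <;> simp only [ha, ha', dif_pos, dif_neg,
      not_false_eq_true] at hxy
    · have := hf₁ hxy
      simp only [Sigma.mk.injEq, Subtype.mk.injEq] at this
      exact Sigma.ext this.1 this.2
    · exact (hne _ _ hxy).elim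
    · exact (hne _ _ hxy.symm).elim
    · have := hf₂ hxy
      simp only [Sigma.mk.injEq, Subtype.mk.injEq] at this
      exact Sigma.ext this.1 this.2
  · rintro ⟨a, e⟩
    by_cases ha : a ∈ bad
    · simp only [ha, dif_pos]
      rw [hf₁l]
      exact (hl ⟨a, ha⟩).1
    · simp only [ha, dif_neg, not_false_eq_true]
      exact hf₂t' ⟨⟨a, ha⟩, e⟩

end Transfer

/-! ### Eigenvalue sequences as sets of units of mass -/

open Cardinal in
theorem Cardinal.sum_option {α : Type} (f : Option α → Cardinal.{u}) :
    Cardinal.sum f = f none + Cardinal.sum fun a => f (some a) := by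
  have e : (Σ o, (f o).out) ≃ (f none).out ⊕ Σ a, (f (some a)).out :=
    { toFun := fun x => match x with
        | ⟨none, e⟩ => Sum.inl e
        | ⟨some a, e⟩ => Sum.inr ⟨a, e⟩
      invFun := fun x => match x with
        | Sum.inl e => ⟨none, e⟩
        | Sum.inr ⟨a, e⟩ => ⟨some a, e⟩
      left_inv := by rintro ⟨_ | a, e⟩ <;> rfl
      right_inv := by rintro (e | ⟨a, e⟩) <;> rfl }
  have h := mk_congr e
  rw [mk_sum, lift_id, lift_id, mk_sigma, mk_sigma] at h
  simpa using h

namespace EigenvalueSequence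

open Cardinal

/-- The points of an eigenvalue sequence together with `0`. -/
def massPoint (s : EigenvalueSequence.{u}) : Option ℕ → ℝ≥0
  | none => 0
  | some k => s.point k

/-- The masses at the points of `massPoint`. -/
def massWeight (s : EigenvalueSequence.{u}) : Option ℕ → Cardinal.{u}
  | none => s.zeroWeight
  | some k => s.weight k

/-- Units of mass of an eigenvalue sequence. -/
abbrev Elem (s : EigenvalueSequence.{u}) : Type u := Σ o, (s.massWeight o).out

open scoped Classical in
theorem toMeasure_eq_sum (s : EigenvalueSequence.{u}) (S : Set ℝ≥0) :
    s.toMeasure S = Cardinal.sum fun o => if s.massPoint o ∈ S then s.massWeight o else 0 := by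
  rw [Cardinal.sum_option]
  rfl

theorem toMeasure_eq_mk (s : EigenvalueSequence.{u}) (S : Set ℝ≥0) :
    s.toMeasure S = #{x : s.Elem | s.massPoint x.1 ∈ S} := by
  classical
  rw [toMeasure_eq_sum]
  have e : {x : s.Elem | s.massPoint x.1 ∈ S} ≃
      Σ o, {_e : (s.massWeight o).out | s.massPoint o ∈ S} :=
    { toFun := fun x => ⟨x.1.1, x.1.2, x.2⟩
      invFun := fun x => ⟨⟨x.1, x.2.1⟩, x.2.2⟩ }
  rw [mk_congr e, mk_sigma]
  congr 1
  ext o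
  by_cases h : s.massPoint o ∈ S <;> simp [h]

/-- Only `0` is log-close to `0`, and a positive point stays away from the tail of a sequence
tending to `0`. -/
theorem finite_setOf_logClose (s t : EigenvalueSequence.{u}) {C : ℝ≥0} (hC : 0 < C)
    (o : Option ℕ) : {o' | LogClose C (s.massPoint o) (t.massPoint o')}.Finite := by
  cases o with
  | none =>
    refine (Set.finite_singleton none).subset fun o' ho' => ?_
    cases o' with
    | none => rfl
    | some l =>
      have h : t.point l ≤ C * 0 := ho'.2
      rw [mul_zero] at h
      exact absurd h (t.isLogSeparated.pos l).not_ge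
  | some k =>
    have h := t.isLogSeparated.tendsto_zero.eventually_lt_const
      (div_pos (s.isLogSeparated.pos k) hC)
    obtain ⟨N, hN⟩ := eventually_atTop.1 h
    refine ((Set.finite_singleton none).union ((Set.finite_Iio N).image some)).subset ?_
    intro o' ho'
    cases o' with
    | none => exact Or.inl rfl
    | some l =>
      refine Or.inr ⟨l, ?_, rfl⟩
      by_contra hl
      have h1 : s.point k ≤ C * t.point l := ho'.1
      exact absurd ((div_le_iff₀' hC).2 h1) (hN l (not_lt.1 hl)).not_ge

/-- Each direction of the interval condition gives an injection moving units by bounded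
log-distance. The bijection from Schröder–Bernstein uses only edges of these two injections, so it
keeps the bound. -/
theorem exists_equiv_logClose {s t : EigenvalueSequence.{u}}
    (h : MutuallySpread s.toMeasure t.toMeasure) :
    ∃ (C : ℝ≥0) (e : s.Elem ≃ t.Elem), 1 < C ∧
      ∀ x, LogClose C (s.massPoint x.1) (t.massPoint (e x).1) := by
  obtain ⟨C, hC, h1, h2⟩ := h
  have hC0 : 0 < C := zero_lt_one.trans hC
  obtain ⟨f, hf, hfc⟩ := exists_injective_logClose (p := s.massPoint) (q := t.massPoint)
    (E := fun o => (s.massWeight o).out) (F := fun o => (t.massWeight o).out) hC0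
    (finite_setOf_logClose s t hC0) fun a b => by
      rw [← toMeasure_eq_mk, ← toMeasure_eq_mk]
      exact h1 a b
  obtain ⟨g, hg, hgc⟩ := exists_injective_logClose (p := t.massPoint) (q := s.massPoint)
    (E := fun o => (t.massWeight o).out) (F := fun o => (s.massWeight o).out) hC0
    (finite_setOf_logClose t s hC0) fun a b => by
      rw [← toMeasure_eq_mk, ← toMeasure_eq_mk]
      exact h2 a b
  obtain ⟨e, he, hec⟩ := Function.Embedding.schroeder_bernstein_of_rel hf hg
    (fun x y => LogClose C (s.massPoint x.1) (t.massPoint y.1)) hfc fun y => (hgc y).symm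
  exact ⟨C, Equiv.ofBijective e he, hC, hec⟩

theorem isCardinalMeasure_mk_preimage {X : Type u} {α : Type*} [MeasurableSpace α] (g : X → α) :
    IsCardinalMeasure fun S => #(g ⁻¹' S) := by
  refine ⟨by simp, fun S _ hd => ?_⟩
  have h := mk_iUnion_eq_sum_mk_lift (f := fun n => g ⁻¹' S n)
    fun i j hij => (hd hij).preimage g
  rwa [lift_uzero, ← Set.preimage_iUnion] at h

/-- The transfer measure counts the units `x` whose pair of positions, before and after the
bijection, lies in the given set. -/
theorem logBoundedShift_of_mutuallySpread {s t : EigenvalueSequence.{u}}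
    (h : MutuallySpread s.toMeasure t.toMeasure) : LogBoundedShift s.toMeasure t.toMeasure := by
  obtain ⟨C, e, hC, he⟩ := exists_equiv_logClose h
  refine ⟨C, fun S => #((fun x => (s.massPoint x.1, t.massPoint (e x).1)) ⁻¹' S), hC,
    isCardinalMeasure_mk_preimage _, fun S _ => ?_, fun S _ => ?_, ?_⟩
  · rw [toMeasure_eq_mk]
    simp [Set.preimage, Set.coe_eq_subtype]
  · rw [toMeasure_eq_mk]
    exact mk_congr (e.subtypeEquiv fun x => by simp)
  · simp only
    rw [mk_eq_zero_iff]
    exact ⟨fun x => x.2 (he _)⟩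

end EigenvalueSequence

/-! ### Rounding the spectrum to a grid -/

section Discretization

variable {lam : ℕ → ℝ≥0}

/-- The partition of `[0, ∞)` into `{0}` and intervals between successive terms of a decreasing
sequence. -/
def logPiece (lam : ℕ → ℝ≥0) : Option ℕ → Set ℝ≥0
  | none => {0}
  | some 0 => Set.Ioi (lam 1)
  | some (k + 1) => Set.Ioc (lam (k + 2)) (lam (k + 1))

theorem measurableSet_logPiece (lam : ℕ → ℝ≥0) : ∀ o, MeasurableSet (logPiece lam o)
  | none => measurableSet_singleton 0
  | some 0 => measurableSet_Ioi
  | some (_ + 1) => measurableSet_Ioc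

theorem lt_of_mem_logPiece_some {k : ℕ} {x : ℝ≥0} (h : x ∈ logPiece lam (some k)) :
    lam (k + 1) < x := by
  cases k with
  | zero => exact h
  | succ k => exact h.1

theorem pairwise_disjoint_logPiece (h : IsLogSeparated lam) :
    Pairwise (Function.onFun Disjoint (logPiece lam)) := by
  have hlt : ∀ i j, i < j → ∀ x ∈ logPiece lam (some i), x ∉ logPiece lam (some j) := by
    intro i j hij x hi hj
    obtain ⟨j, rfl⟩ := Nat.exists_eq_succ_of_ne_zero (Nat.ne_zero_of_lt hij)
    have h1 : x ≤ lam (j + 1) := hj.2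
    have h2 : lam (j + 1) ≤ lam (i + 1) := h.strictAnti.antitone hij
    exact absurd (lt_of_mem_logPiece_some hi) (h1.trans h2).not_gt
  have h0 : ∀ i, ∀ x ∈ logPiece lam (some i), x ∉ logPiece lam none := by
    intro i x hi hx
    rw [show x = 0 from hx] at hi
    exact not_lt_bot (lt_of_mem_logPiece_some hi)
  intro o o' hoo
  rw [Function.onFun, Set.disjoint_left]
  intro x hx hx'
  cases o with
  | none =>
    cases o' with
    | none => exact hoo rfl
    | some j => exact h0 j x hx' hx
  | some i =>
    cases o' with
    | none => exact h0 i x hx hx'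
    | some j =>
      have hne : i ≠ j := fun he => hoo (congrArg some he)
      rcases hne.lt_or_gt with hij | hij
      exacts [hlt i j hij x hx hx', hlt j i hij x hx' hx]

theorem exists_mem_logPiece (h : IsLogSeparated lam) (x : ℝ≥0) : ∃ o, x ∈ logPiece lam o := by
  classical
  rcases eq_zero_or_pos x with rfl | hx
  · exact ⟨none, rfl⟩
  have hex : ∃ k, lam (k + 1) < x := by
    have := ((tendsto_add_atTop_iff_nat 1).2 h.tendsto_zero).eventually_lt_const hx
    exact this.exists
  refine ⟨some (Nat.find hex), ?_⟩
  have h1 := Nat.find_spec hex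
  cases hk : Nat.find hex with
  | zero => rwa [hk] at h1
  | succ k =>
    rw [hk] at h1
    exact ⟨h1, not_lt.1 (Nat.find_min hex (hk ▸ Nat.lt_succ_self k))⟩

theorem logClose_of_mem_logPiece {C x : ℝ≥0} (hC : ∀ k, lam k ≤ C * lam (k + 1)) {k : ℕ}
    (hx : x ∈ logPiece lam (some k)) (h0 : x ≤ C * lam 0) (h1 : 1 ≤ C) :
    LogClose C x (lam k) := by
  refine ⟨?_, (hC k).trans (mul_le_mul_right (lt_of_mem_logPiece_some hx).le C)⟩
  cases k with
  | zero => exact h0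
  | succ k => exact hx.2.trans (le_mul_of_one_le_left zero_le h1)

variable {H : Type u} [NormedAddCommGroup H] [InnerProductSpace ℂ H] [CompleteSpace H]
variable {K : Type v} [NormedAddCommGroup K] [InnerProductSpace ℂ K] [CompleteSpace K]

/-- The eigenvalue sequence obtained by rounding the singular values of `T`. -/
noncomputable def discretization (T : H →L[ℂ] K) (lam : ℕ → ℝ≥0) (h : IsLogSeparated lam) :
    EigenvalueSequence.{u} where
  point := lam
  isLogSeparated := h
  zeroWeight := dimSpectralMeasure T (logPiece lam none)
  weight k := dimSpectralMeasure T (logPiece lam (some k))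

theorem massWeight_discretization (T : H →L[ℂ] K) (h : IsLogSeparated lam) (o : Option ℕ) :
    (discretization T lam h).massWeight o = dimSpectralMeasure T (logPiece lam o) := by
  cases o <;> rfl

/-- The transfer measure is the image of `m` on the graph of `g`. -/
theorem IsCardinalMeasure.logBoundedShift_map {m m' : Set ℝ≥0 → Cardinal.{u}}
    (hm : IsCardinalMeasure m) {g : ℝ≥0 → ℝ≥0} (hg : Measurable g) {C : ℝ≥0} (hC : 1 < C)
    (h0 : m {x | ¬ LogClose C x (g x)} = 0) (hm' : ∀ S, MeasurableSet S → m (g ⁻¹' S) = m' S) :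
    LogBoundedShift m m' := by
  have hg' : Measurable fun x => (x, g x) := measurable_id.prodMk hg
  refine ⟨C, fun S => m ((fun x => (x, g x)) ⁻¹' S), hC, ⟨hm.empty, fun S hS hd => ?_⟩,
    fun S _ => ?_, fun S hS => ?_, h0⟩
  · rw [Set.preimage_iUnion]
    exact hm.iUnion _ (fun n => hg' (hS n)) fun i j hij => (hd hij).preimage _
  · have : (fun x => (x, g x)) ⁻¹' (S ×ˢ Set.univ) = S := by
      ext x
      simp
    exact congrArg m this
  · have : (fun x => (x, g x)) ⁻¹' (Set.univ ×ˢ S) = g ⁻¹' S := by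
      ext x
      simp
    exact (congrArg m this).trans (hm' S hS)

theorem exists_logClose_of_mem_logPiece (T : H →L[ℂ] K) (h : IsLogSeparated lam)
    (hb : ∃ C : ℝ≥0, ∀ k, lam k ≤ C * lam (k + 1)) (M : ℝ≥0) :
    ∃ C : ℝ≥0, 1 < C ∧ ∀ o, ∀ x ∈ logPiece lam o, x ≤ M →
      LogClose C x ((discretization T lam h).massPoint o) := by
  obtain ⟨C₀, hC₀⟩ := hb
  -- The term `M / lam 0` is needed because the first piece is unbounded above: points up to `M` are
  -- rounded to `lam 0`.
  obtain ⟨C, hCC₀, hC2, hCM⟩ : ∃ C : ℝ≥0, C₀ ≤ C ∧ 2 ≤ C ∧ M / lam 0 ≤ C :=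
    ⟨max C₀ (max 2 (M / lam 0)), le_max_left _ _,
      (le_max_left _ _).trans (le_max_right _ _), (le_max_right _ _).trans (le_max_right _ _)⟩
  have hC1 : 1 < C := one_lt_two.trans_le hC2
  refine ⟨C, hC1, fun o x hx hxM => ?_⟩
  cases o with
  | none =>
    rw [show x = 0 from hx]
    exact ⟨zero_le, zero_le⟩
  | some k =>
    refine logClose_of_mem_logPiece (fun k => (hC₀ k).trans ?_) hx ?_ hC1.le
    · exact mul_le_mul_left hCC₀ _
    · exact hxM.trans ((div_le_iff₀ (h.pos 0)).1 hCM)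

/-- Rounding each `x` to the grid point of its piece is a measurable map, since every preimage is a
countable union of pieces. Above `‖absOp T‖₊`, where it may be far from the identity, there is no
mass. -/
theorem discretization_isOf (T : H →L[ℂ] K) (h : IsLogSeparated lam)
    (hb : ∃ C : ℝ≥0, ∀ k, lam k ≤ C * lam (k + 1)) : (discretization T lam h).IsOf T := by
  classical
  have hD := isCardinalMeasure_dimSpectralMeasure T
  obtain ⟨C, hC1, hC⟩ := exists_logClose_of_mem_logPiece T h hb ‖absOp T‖₊
  choose idx hidx using exists_mem_logPiece h
  have hidx' : ∀ x o, x ∈ logPiece lam o → idx x = o := fun x o hx => by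
    by_contra hne
    exact Set.disjoint_left.1 (pairwise_disjoint_logPiece h hne) (hidx x) hx
  have hpre : ∀ S : Set ℝ≥0, (fun x => (discretization T lam h).massPoint (idx x)) ⁻¹' S =
      ⋃ o, if (discretization T lam h).massPoint o ∈ S then logPiece lam o else ∅ := by
    intro S
    ext x
    simp only [Set.mem_preimage, Set.mem_iUnion]
    constructor
    · intro hx
      refine ⟨idx x, ?_⟩
      rw [if_pos hx]
      exact hidx x
    · rintro ⟨o, ho⟩
      split_ifs at ho with hoS
      · rwa [hidx' x o ho]
      · exact ho.elim
  have hmo : ∀ (S : Set ℝ≥0) (o : Option ℕ), MeasurableSet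
      (if (discretization T lam h).massPoint o ∈ S then logPiece lam o else ∅) := fun S o => by
    split_ifs
    exacts [measurableSet_logPiece lam o, MeasurableSet.empty]
  refine hD.logBoundedShift_map
    (g := fun x => (discretization T lam h).massPoint (idx x)) (fun S _ => ?_) hC1 ?_ fun S hS => ?_
  · rw [hpre]
    exact MeasurableSet.iUnion (hmo S)
  · refine dimSpectralMeasure_eq_zero_of_norm_lt T fun x hx => ?_
    by_contra hM
    exact hx (hC _ x (hidx x) (not_lt.1 hM))
  · rw [hpre, dimSpectralMeasure_iUnion T _ (hmo S), EigenvalueSequence.toMeasure_eq_sum]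
    · congr 1
      ext o
      split_ifs
      · exact (massWeight_discretization T h o).symm
      · exact hD.empty
    · intro o o' hoo
      refine Disjoint.mono ?_ ?_ (pairwise_disjoint_logPiece h hoo) <;>
      · simp only
        split_ifs
        exacts [subset_rfl, Set.empty_subset _]

end Discretization

/-! ### Topological equivalence as comparability of norms -/

section NormComparison

variable {H₁ H₂ : Type u} {K₁ K₂ : Type v}
  [NormedAddCommGroup H₁] [InnerProductSpace ℂ H₁] [NormedAddCommGroup H₂] [InnerProductSpace ℂ H₂]
  [NormedAddCommGroup K₁] [InnerProductSpace ℂ K₁] [NormedAddCommGroup K₂] [InnerProductSpace ℂ K₂]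
  {T₁ : H₁ →L[ℂ] K₁} {T₂ : H₂ →L[ℂ] K₂}

/-- The isomorphism `U` of the domains makes the norms of `x`, `T₁ x` comparable with the norms
of `U x`, `T₂ (U x)`. -/
structure NormComparable (T₁ : H₁ →L[ℂ] K₁) (T₂ : H₂ →L[ℂ] K₂) (U : H₁ ≃L[ℂ] H₂) (c : ℝ≥0) :
    Prop where
  norm_map_le : ∀ x, ‖U x‖ ≤ c * ‖x‖
  le_norm_map : ∀ x, ‖x‖ ≤ c * ‖U x‖
  norm_left_le : ∀ x, ‖T₁ x‖ ≤ c * ‖T₂ (U x)‖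
  norm_right_le : ∀ x, ‖T₂ (U x)‖ ≤ c * ‖T₁ x‖

theorem NormComparable.symm {U : H₁ ≃L[ℂ] H₂} {c : ℝ≥0} (h : NormComparable T₁ T₂ U c) :
    NormComparable T₂ T₁ U.symm c where
  norm_map_le y := by simpa using h.le_norm_map (U.symm y)
  le_norm_map y := by simpa using h.norm_map_le (U.symm y)
  norm_left_le y := by simpa using h.norm_right_le (U.symm y)
  norm_right_le y := by simpa using h.norm_left_le (U.symm y)

theorem norm_toClosureRange (T : H₁ →L[ℂ] K₁) (x : H₁) : ‖toClosureRange T x‖ = ‖T x‖ := rfl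

theorem denseRange_toClosureRange (T : H₁ →L[ℂ] K₁) : DenseRange (toClosureRange T) := by
  intro y
  rw [closure_subtype]
  have : (Subtype.val '' Set.range (toClosureRange T)) =
      (LinearMap.range T.toLinearMap : Set K₁) := by
    ext z
    constructor
    · rintro ⟨_, ⟨x, rfl⟩, rfl⟩
      exact ⟨x, rfl⟩
    · rintro ⟨x, rfl⟩
      exact ⟨toClosureRange T x, ⟨x, rfl⟩, rfl⟩
  rw [this]
  exact y.2

theorem TopEquivalent.normComparable {Y₁ Y₂ : Type*} [NormedAddCommGroup Y₁] [NormedSpace ℂ Y₁]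
    [NormedAddCommGroup Y₂] [NormedSpace ℂ Y₂] {S₁ : H₁ →L[ℂ] Y₁} {S₂ : H₂ →L[ℂ] Y₂}
    (h : TopEquivalent S₁ S₂) (h₁ : ∀ x, ‖S₁ x‖ = ‖T₁ x‖) (h₂ : ∀ x, ‖S₂ x‖ = ‖T₂ x‖) :
    ∃ U c, NormComparable T₁ T₂ U c := by
  obtain ⟨U, V, h⟩ := h
  have hS : ∀ x, S₁ x = V.symm (S₂ (U x)) := fun x => by
    rw [h]
    rfl
  have hS' : ∀ x, S₂ (U x) = V (S₁ x) := fun x => by rw [hS, V.apply_symm_apply]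
  obtain ⟨c, hc1, hc2, hc3, hc4⟩ : ∃ c : ℝ≥0, ‖(U : H₁ →L[ℂ] H₂)‖₊ ≤ c ∧
      ‖(U.symm : H₂ →L[ℂ] H₁)‖₊ ≤ c ∧ ‖(V : Y₁ →L[ℂ] Y₂)‖₊ ≤ c ∧
      ‖(V.symm : Y₂ →L[ℂ] Y₁)‖₊ ≤ c :=
    ⟨_ + (_ + (_ + _)), le_self_add, le_self_add.trans le_add_self,
      (le_self_add.trans le_add_self).trans le_add_self,
      (le_add_self.trans le_add_self).trans le_add_self⟩
  refine ⟨U, c, fun x => ?_, fun x => ?_, fun x => ?_, fun x => ?_⟩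
  · exact (U : H₁ →L[ℂ] H₂).le_of_opNorm_le hc1 x
  · simpa using (U.symm : H₂ →L[ℂ] H₁).le_of_opNorm_le hc2 (U x)
  · rw [← h₁, ← h₂, hS]
    exact (V.symm : Y₂ →L[ℂ] Y₁).le_of_opNorm_le hc4 _
  · rw [← h₁, ← h₂, hS']
    exact (V : Y₁ →L[ℂ] Y₂).le_of_opNorm_le hc3 _

/-- Comparability makes `T₁ x ↦ T₂ (U x)` well defined and bounded in both directions between the
images, which are dense in their closures. -/
theorem NormComparable.exists_equiv [CompleteSpace K₁] [CompleteSpace K₂]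
    {U : H₁ ≃L[ℂ] H₂} {c : ℝ≥0} (h : NormComparable T₁ T₂ U c) :
    ∃ V : (LinearMap.range T₁.toLinearMap).topologicalClosure ≃L[ℂ]
      (LinearMap.range T₂.toLinearMap).topologicalClosure,
      ∀ x, V (toClosureRange T₁ x) = toClosureRange T₂ (U x) := by
  have hd₁ : DenseRange (toClosureRange T₁).toLinearMap := denseRange_toClosureRange T₁
  have hd₂ : DenseRange (toClosureRange T₂).toLinearMap := denseRange_toClosureRange T₂
  exact ⟨U.toLinearEquiv.extend _ _ hd₁ ⟨c, h.norm_right_le⟩ hd₂ ⟨c, h.symm.norm_right_le⟩,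
    fun x => LinearEquiv.extend_eq U.toLinearEquiv _ _ hd₁ _ hd₂ _ x⟩

theorem NormComparable.topEquivalent_toClosureRange [CompleteSpace K₁] [CompleteSpace K₂]
    {U : H₁ ≃L[ℂ] H₂} {c : ℝ≥0} (h : NormComparable T₁ T₂ U c) :
    TopEquivalent (toClosureRange T₁) (toClosureRange T₂) := by
  obtain ⟨V, hV⟩ := h.exists_equiv
  refine ⟨U, V, ContinuousLinearMap.ext fun x => ?_⟩
  change _ = V.symm (toClosureRange T₂ (U x))
  rw [← hV, V.symm_apply_apply]

/-- A Hilbert space is the product of a closed subspace and its orthogonal complement. -/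
noncomputable def Submodule.prodOrthogonalEquiv {X : Type*} [NormedAddCommGroup X]
    [InnerProductSpace ℂ X] (Y : Submodule ℂ X) [Y.HasOrthogonalProjection] : X ≃L[ℂ] Y × Yᗮ :=
  Y.orthogonalDecomposition.toContinuousLinearEquiv.trans (WithLp.prodContinuousLinearEquiv 2 ℂ _ _)

theorem Submodule.prodOrthogonalEquiv_coe {X : Type*} [NormedAddCommGroup X]
    [InnerProductSpace ℂ X] (Y : Submodule ℂ X) [Y.HasOrthogonalProjection] (y : Y) :
    Y.prodOrthogonalEquiv y = (y, 0) := by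
  simp [Submodule.prodOrthogonalEquiv]

theorem NormComparable.topEquivalent [CompleteSpace K₁] [CompleteSpace K₂]
    {U : H₁ ≃L[ℂ] H₂} {c : ℝ≥0} (h : NormComparable T₁ T₂ U c)
    (hdim : hilbertDim (LinearMap.range T₁.toLinearMap)ᗮ =
      hilbertDim (LinearMap.range T₂.toLinearMap)ᗮ) : TopEquivalent T₁ T₂ := by
  rw [← Submodule.orthogonal_closure (LinearMap.range T₁.toLinearMap),
    ← Submodule.orthogonal_closure (LinearMap.range T₂.toLinearMap)] at hdim
  set Y₁ := (LinearMap.range T₁.toLinearMap).topologicalClosure with hY₁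
  set Y₂ := (LinearMap.range T₂.toLinearMap).topologicalClosure with hY₂
  obtain ⟨V, hV⟩ : ∃ V : Y₁ ≃L[ℂ] Y₂, ∀ x, V (toClosureRange T₁ x) = toClosureRange T₂ (U x) :=
    h.exists_equiv
  have : CompleteSpace Y₁ := (Submodule.isClosed_topologicalClosure _).completeSpace_coe
  have : CompleteSpace Y₂ := (Submodule.isClosed_topologicalClosure _).completeSpace_coe
  obtain ⟨w, b, -⟩ := exists_hilbertBasis ℂ Y₁ᗮ
  rw [hilbertDim_eq_mk b] at hdim
  obtain ⟨d⟩ := exists_hilbertBasis_of_mk_eq hdim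
  -- Equal dimensions allow any unitary between the complements; `V` and `W` together act on the
  -- codomains.
  let W : Y₁ᗮ ≃L[ℂ] Y₂ᗮ := (b.repr.trans d.repr.symm).toContinuousLinearEquiv
  let V' : K₁ ≃L[ℂ] K₂ :=
    (Y₁.prodOrthogonalEquiv.trans (V.prodCongr W)).trans Y₂.prodOrthogonalEquiv.symm
  have hV' : ∀ x, V' (T₁ x) = T₂ (U x) := fun x => by
    change Y₂.prodOrthogonalEquiv.symm ((V.prodCongr W) (Y₁.prodOrthogonalEquiv
      (toClosureRange T₁ x : Y₁))) = (toClosureRange T₂ (U x) : Y₂)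
    rw [ContinuousLinearEquiv.symm_apply_eq, Submodule.prodOrthogonalEquiv_coe,
      Submodule.prodOrthogonalEquiv_coe, ← hV]
    simp
  refine ⟨U, V', ContinuousLinearMap.ext fun x => ?_⟩
  change _ = V'.symm (T₂ (U x))
  rw [← hV', V'.symm_apply_apply]

theorem TopEquivalent.symm (h : TopEquivalent T₁ T₂) : TopEquivalent T₂ T₁ := by
  obtain ⟨U, V, h⟩ := h
  refine ⟨U.symm, V.symm, ContinuousLinearMap.ext fun x => ?_⟩
  rw [h]
  simp

/-- `V` need not preserve orthogonality, so it is followed by the projection onto `R₂ᗮ`. A vector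
`z` of `R₁ᗮ` killed by this has `V z` in the closure of `R₂`, so `z` lies in the closure of `R₁` and
is orthogonal to itself. -/
theorem TopEquivalent.hilbertDim_orthogonal_le [CompleteSpace K₁] [CompleteSpace K₂]
    (h : TopEquivalent T₁ T₂) :
    hilbertDim (LinearMap.range T₁.toLinearMap)ᗮ ≤
      hilbertDim (LinearMap.range T₂.toLinearMap)ᗮ := by
  obtain ⟨U, V, h⟩ := h
  set R₁ := LinearMap.range T₁.toLinearMap with hR₁
  set R₂ := LinearMap.range T₂.toLinearMap with hR₂
  refine hilbertDim_le_of_injective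
    (R₂ᗮ.orthogonalProjectionOnto ∘L (V : K₁ →L[ℂ] K₂) ∘L R₁ᗮ.subtypeL) ?_
  refine (injective_iff_map_eq_zero _).2 fun z hz => ?_
  have hz1 : V z ∈ R₂ᗮᗮ := Submodule.orthogonalProjectionOnto_eq_zero_iff.1 hz
  rw [Submodule.orthogonal_orthogonal_eq_closure] at hz1
  have hz2 : (z : K₁) ∈ R₁.topologicalClosure := by
    have h1 := map_mem_closure V.symm.continuous hz1 (t := (R₁ : Set K₁)) (by
      rintro _ ⟨y, rfl⟩
      refine ⟨U.symm y, ?_⟩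
      rw [h]
      simp)
    have h2 : (z : K₁) ∈ closure (R₁ : Set K₁) := by simpa using h1
    exact h2
  rw [← Submodule.orthogonal_orthogonal_eq_closure] at hz2
  exact Subtype.ext (inner_self_eq_zero.1 ((Submodule.mem_orthogonal _ _).1 hz2 z z.2))

end NormComparison

/-! ### Comparable operators have mutually spread spectral measures -/

section Spread

variable {H₁ H₂ : Type u} {K₁ K₂ : Type v}
  [NormedAddCommGroup H₁] [InnerProductSpace ℂ H₁] [NormedAddCommGroup H₂] [InnerProductSpace ℂ H₂]
  [NormedAddCommGroup K₁] [InnerProductSpace ℂ K₁] [NormedAddCommGroup K₂] [InnerProductSpace ℂ K₂]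
  [CompleteSpace H₁] [CompleteSpace H₂] [CompleteSpace K₁] [CompleteSpace K₂]
  {T₁ : H₁ →L[ℂ] K₁} {T₂ : H₂ →L[ℂ] K₂}

theorem norm_le_norm_add_of_inner_eq_zero {X : Type*} [NormedAddCommGroup X]
    [InnerProductSpace ℂ X] {x y : X} (h : ⟪x, y⟫_ℂ = 0) : ‖x‖ ≤ ‖x + y‖ := by
  have := norm_add_sq_eq_norm_sq_add_norm_sq_of_inner_eq_zero x y h
  nlinarith [norm_nonneg x, norm_nonneg y, norm_nonneg (x + y)]

theorem mem_spectralSubspace_inter {H : Type u} [NormedAddCommGroup H] [InnerProductSpace ℂ H]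
    [CompleteSpace H] {A : H →L[ℂ] H} {x : H} {S S' : Set ℝ} (h : x ∈ spectralSubspace A S)
    (h' : x ∈ spectralSubspace A S') : x ∈ spectralSubspace A (S ∩ S') := by
  rw [mem_spectralSubspace, Set.compl_inter]
  exact measure_union_null h h'

theorem eq_zero_of_apply_eq_zero_of_mem {H : Type u} [NormedAddCommGroup H]
    [InnerProductSpace ℂ H] [CompleteSpace H] {A : H →L[ℂ] H} (hA : IsSelfAdjoint A) {x : H}
    {S : Set ℝ} (hS : (0 : ℝ) ∉ S) (h : x ∈ spectralSubspace A S) (hx : A x = 0) : x = 0 := by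
  have h0 := (mem_spectralSubspace_singleton_zero hA).2 hx
  have h1 : x ∈ spectralSubspace A ({0}ᶜ) :=
    spectralSubspace_mono (Set.subset_compl_singleton_iff.2 hS) h
  exact inner_self_eq_zero.1 (inner_eq_zero_of_mem_compl hA (measurableSet_singleton 0) h0 h1)

/-- A vector without components near `[a, b]` is split by the spectral measure into a part below
and a part above. -/
theorem exists_add_of_inner_eq_zero {H : Type u} [NormedAddCommGroup H]
    [InnerProductSpace ℂ H] [CompleteSpace H] {A : H →L[ℂ] H} (hA : IsSelfAdjoint A) {w : H}
    {a b : ℝ} (h : ∀ v ∈ spectralSubspace A (Set.Icc a b), ⟪v, w⟫_ℂ = 0) :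
    ∃ y ∈ spectralSubspace A (Set.Iio a), ∃ z ∈ spectralSubspace A (Set.Ici a ∩ Set.Ioi b),
      w = y + z := by
  obtain ⟨y, hy, z, hz, rfl, -⟩ := exists_spectral_decomposition hA (measurableSet_Iio (a := a)) w
  refine ⟨y, hy, z, ?_, rfl⟩
  have h1 : ∀ v ∈ spectralSubspace A (Set.Icc a b), ⟪v, z⟫_ℂ = 0 := fun v hv => by
    have h2 := h v hv
    have h3 : ⟪v, y⟫_ℂ = 0 := inner_eq_zero_of_disjoint hA measurableSet_Icc
      (Set.disjoint_left.2 fun t ht ht' => absurd ht.1 (not_le.2 ht')) hv hy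
    rwa [inner_add_right, h3, zero_add] at h2
  have h4 := mem_spectralSubspace_compl_of_inner_eq_zero hA measurableSet_Icc h1
  refine spectralSubspace_mono ?_ (mem_spectralSubspace_inter hz h4)
  rintro t ⟨ht, ht'⟩
  have hta : a ≤ t := not_lt.1 ht
  exact ⟨hta, lt_of_not_ge fun htb => ht' ⟨hta, htb⟩⟩

theorem coe_image_Icc (a b : ℝ≥0) :
    (fun t : ℝ≥0 => (t : ℝ)) '' Set.Icc a b = Set.Icc (a : ℝ) b := by
  ext t
  constructor
  · rintro ⟨r, hr, rfl⟩
    exact ⟨NNReal.coe_le_coe.2 hr.1, NNReal.coe_le_coe.2 hr.2⟩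
  · rintro ⟨h1, h2⟩
    exact ⟨⟨t, a.2.trans h1⟩, ⟨h1, h2⟩, rfl⟩

theorem dimSpectralMeasure_Icc (T : H₁ →L[ℂ] K₁) (a b : ℝ≥0) :
    dimSpectralMeasure T (Set.Icc a b) =
      hilbertDim (spectralSubspace (absOp T) (Set.Icc (a : ℝ) b)) := by
  rw [dimSpectralMeasure, coe_image_Icc]

/-- The vector `U x` splits into a part `U x₀` below `a / C` and a part `U x₁` above `C * b`. Then
`T₁ x₀` is small because `T₂` is small on the first part, and `x₁` is small because `T₂` is large on
the second. Each accounts for at most the fraction `c ^ 2 / C` of `‖T₁ x‖ ^ 2`, so `C > 2 * c ^ 2`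
forces `T₁ x = 0`. -/
theorem NormComparable.eq_zero_of_inner_eq_zero {U : H₁ ≃L[ℂ] H₂} {c : ℝ≥0}
    (h : NormComparable T₁ T₂ U c) {C a b : ℝ≥0} (hC : 2 * c ^ 2 < C) {x : H₁}
    (hx : x ∈ spectralSubspace (absOp T₁) (Set.Icc (a : ℝ) b))
    (hx' : ∀ v ∈ spectralSubspace (absOp T₂) (Set.Icc ((a / C : ℝ≥0) : ℝ) (C * b : ℝ≥0)),
      ⟪v, U x⟫_ℂ = 0) : x = 0 := by
  have hA₁ := isSelfAdjoint_absOp T₁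
  have hA₂ := isSelfAdjoint_absOp T₂
  have hC0 : 0 < C := zero_le.trans_lt hC
  have hC0' : (0 : ℝ) < C := hC0
  obtain ⟨y₀, hy₀, y₁, hy₁, hw⟩ := exists_add_of_inner_eq_zero hA₂ hx'
  obtain ⟨x₀, rfl⟩ := U.surjective y₀
  obtain ⟨x₁, rfl⟩ := U.surjective y₁
  have hxx : x = x₀ + x₁ := U.injective (by rw [hw, map_add])
  have horth : ⟪U x₀, U x₁⟫_ℂ = 0 := inner_eq_zero_of_disjoint hA₂ measurableSet_Iio
    (Set.disjoint_left.2 fun t ht ht' => absurd (Set.mem_Ici.1 ht'.1) (not_le.2 ht)) hy₀ hy₁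
  have horth' : ⟪T₂ (U x₁), T₂ (U x₀)⟫_ℂ = 0 := by
    rw [← inner_absOp]
    refine inner_eq_zero_of_disjoint hA₂ (measurableSet_Ici.inter measurableSet_Ioi)
      (Set.disjoint_left.2 fun t ht ht' => absurd (Set.mem_Ici.1 ht.1) (not_le.2 ht'))
      (spectralSubspace_apply_mem hA₂ (measurableSet_Ici.inter measurableSet_Ioi) hy₁)
      (spectralSubspace_apply_mem hA₂ measurableSet_Iio hy₀)
  have hTw : ‖T₂ (U x₁)‖ ≤ ‖T₂ (U x)‖ := by
    rw [hw, map_add, add_comm]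
    exact norm_le_norm_add_of_inner_eq_zero horth'
  have hax : a * ‖x‖ ≤ ‖T₁ x‖ := by
    rw [← norm_absOp]
    exact le_norm_apply_of_mem hA₁ a.2 (fun t _ ht => ht.1.trans (le_abs_self t)) hx
  have hbx : ‖absOp T₁ (absOp T₁ x)‖ ≤ b * ‖T₁ x‖ := by
    rw [← norm_absOp T₁ x]
    refine norm_apply_le_of_mem hA₁ b.2 (fun t _ ht => ?_)
      (spectralSubspace_apply_mem hA₁ measurableSet_Icc hx)
    rw [abs_of_nonneg (a.2.trans ht.1)]
    exact ht.2
  have hlow : C * ‖T₁ x₀‖ ≤ c ^ 2 * ‖T₁ x‖ := by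
    have h1 : ‖T₂ (U x₀)‖ ≤ (a / C : ℝ≥0) * ‖U x₀‖ := by
      rw [← norm_absOp]
      refine norm_apply_le_of_mem hA₂ NNReal.zero_le_coe (fun t hts ht => ?_) hy₀
      rw [abs_of_nonneg (nonneg_of_mem_spectrum_absOp T₂ hts)]
      exact le_of_lt ht
    have h2 : ‖U x₀‖ ≤ c * ‖x‖ := by
      refine le_trans ?_ (h.norm_map_le x)
      rw [hw]
      exact norm_le_norm_add_of_inner_eq_zero horth
    have h3 := h.norm_left_le x₀
    push_cast at h1
    calc C * ‖T₁ x₀‖ ≤ C * (c * (a / C * (c * ‖x‖))) := by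
          gcongr
          refine h3.trans ?_
          gcongr
          refine h1.trans ?_
          gcongr
      _ = c ^ 2 * (a * ‖x‖) := by
          field_simp
      _ ≤ c ^ 2 * ‖T₁ x‖ := by gcongr
  have hhigh : C * b * ‖x₁‖ ≤ c ^ 2 * ‖T₁ x‖ := by
    have h1 : ((C * b : ℝ≥0) : ℝ) * ‖U x₁‖ ≤ ‖T₂ (U x₁)‖ := by
      rw [← norm_absOp]
      exact le_norm_apply_of_mem hA₂ NNReal.zero_le_coe
        (fun t _ ht => (le_of_lt ht.2).trans (le_abs_self t)) hy₁
    have h2 := h.le_norm_map x₁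
    push_cast at h1
    calc C * b * ‖x₁‖ ≤ C * b * (c * ‖U x₁‖) := by gcongr
      _ = c * (C * b * ‖U x₁‖) := by ring
      _ ≤ c * (c * ‖T₁ x‖) := by
          exact mul_le_mul_of_nonneg_left (h1.trans (hTw.trans (h.norm_right_le x))) c.2
      _ = c ^ 2 * ‖T₁ x‖ := by ring
  have hT₁ : T₁ x = 0 := by
    -- Moving `T₁` to the other side in the `x₁` term trades `T₁ x₁`, which is not controlled, for
    -- `x₁` and the bound `b` of `absOp T₁` on its spectral subspace.
    have h1 : ‖T₁ x‖ ^ 2 ≤ ‖T₁ x₀‖ * ‖T₁ x‖ + ‖x₁‖ * (b * ‖T₁ x‖) := by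
      have h2 : ⟪T₁ x, T₁ x⟫_ℂ = ⟪T₁ x₀, T₁ x⟫_ℂ + ⟪x₁, absOp T₁ (absOp T₁ x)⟫_ℂ := by
        rw [absOp_absOp, ContinuousLinearMap.adjoint_inner_right, ← inner_add_left, ← map_add,
          ← hxx]
      have h3 : ‖T₁ x‖ ^ 2 = ‖⟪T₁ x, T₁ x⟫_ℂ‖ := by
        rw [inner_self_eq_norm_sq_to_K]
        simp
      rw [h3, h2]
      refine (norm_add_le _ _).trans (add_le_add (norm_inner_le_norm _ _) ?_)
      refine (norm_inner_le_norm _ _).trans ?_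
      gcongr
    have h4 : (C : ℝ) * ‖T₁ x‖ ^ 2 ≤ 2 * c ^ 2 * ‖T₁ x‖ ^ 2 := by
      nlinarith [norm_nonneg (T₁ x)]
    have h5 : (2 * c ^ 2 : ℝ) < C := by exact_mod_cast hC
    have h6 : ‖T₁ x‖ ^ 2 ≤ 0 := by
      by_contra! hpos
      nlinarith
    exact norm_eq_zero.1 (pow_eq_zero_iff two_ne_zero |>.1 (le_antisymm h6 (sq_nonneg _)))
  have hT₂ : T₂ (U x) = 0 := by
    have := h.norm_right_le x
    rw [hT₁, norm_zero, mul_zero] at this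
    exact norm_le_zero_iff.1 this
  have hT₂₁ : T₂ (U x₁) = 0 := by
    rw [hT₂, norm_zero] at hTw
    exact norm_le_zero_iff.1 hTw
  have hker : ∀ {y : H₂}, T₂ y = 0 → absOp T₂ y = 0 := fun hy => by
    rw [← norm_eq_zero, norm_absOp, hy, norm_zero]
  have hy₁0 : U x₁ = 0 := by
    refine eq_zero_of_apply_eq_zero_of_mem hA₂ (fun h0 => ?_) hy₁ (hker hT₂₁)
    exact absurd h0.2 (not_lt.2 NNReal.zero_le_coe)
  -- For `a = 0` the kernel of `T₁` is allowed in the subspace, but then the lower part lives on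
  -- negative numbers, where there is no spectrum. For `a > 0` the operator is injective on the
  -- subspace.
  rcases eq_zero_or_pos a with rfl | ha
  · have hT₂₀ : T₂ (U x₀) = 0 := by
      rwa [hw, map_add, hT₂₁, add_zero] at hT₂
    have hy₀0 : U x₀ = 0 := by
      refine eq_zero_of_apply_eq_zero_of_mem hA₂ (fun h0 => ?_) hy₀ (hker hT₂₀)
      simp at h0
    apply U.injective
    rw [hw, hy₀0, hy₁0, add_zero, map_zero]
  · refine eq_zero_of_apply_eq_zero_of_mem hA₁ (fun h0 => ?_) hx ?_
    · exact absurd h0.1 (not_le.2 ha)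
    · rw [← norm_eq_zero, norm_absOp, hT₁, norm_zero]

theorem NormComparable.spreadsInto {U : H₁ ≃L[ℂ] H₂} {c : ℝ≥0} (h : NormComparable T₁ T₂ U c)
    {C : ℝ≥0} (hC : 2 * c ^ 2 < C) :
    SpreadsInto C (dimSpectralMeasure T₁) (dimSpectralMeasure T₂) := by
  intro a b
  rw [dimSpectralMeasure_Icc, dimSpectralMeasure_Icc]
  set E₁ := spectralSubspace (absOp T₁) (Set.Icc (a : ℝ) b)
  set E₂ := spectralSubspace (absOp T₂) (Set.Icc ((a / C : ℝ≥0) : ℝ) (C * b : ℝ≥0))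
  have := completeSpace_spectralSubspace (isSelfAdjoint_absOp T₁) (Set.Icc (a : ℝ) b)
  have : CompleteSpace E₂ := completeSpace_spectralSubspace (isSelfAdjoint_absOp T₂) _
  refine hilbertDim_le_of_injective
    (E₂.orthogonalProjectionOnto ∘L (U : H₁ →L[ℂ] H₂) ∘L E₁.subtypeL) ?_
  refine (injective_iff_map_eq_zero _).2 fun x hx => Subtype.ext ?_
  refine h.eq_zero_of_inner_eq_zero hC x.2 fun v hv => ?_
  have hx' : U x ∈ E₂ᗮ := Submodule.orthogonalProjectionOnto_eq_zero_iff.1 hx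
  exact (Submodule.mem_orthogonal _ _).1 hx' v hv

theorem NormComparable.mutuallySpread {U : H₁ ≃L[ℂ] H₂} {c : ℝ≥0}
    (h : NormComparable T₁ T₂ U c) :
    MutuallySpread (dimSpectralMeasure T₁) (dimSpectralMeasure T₂) := by
  have h1 : 1 < 2 * c ^ 2 + 2 := by
    have : (1 : ℝ≥0) < 2 := one_lt_two
    exact this.trans_le le_add_self
  have h2 : 2 * c ^ 2 < 2 * c ^ 2 + 2 := lt_add_of_pos_right _ two_pos
  exact ⟨2 * c ^ 2 + 2, h1, h.spreadsInto h2, h.symm.spreadsInto h2⟩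

end Spread

/-! ### Diagonalisation up to bounded factors and the construction of `U` -/

section Diagonal

theorem HilbertBasis.enorm_sq_eq_tsum {X ι : Type*} [NormedAddCommGroup X]
    [InnerProductSpace ℂ X] (b : HilbertBasis ι ℂ X) (x : X) :
    ‖x‖ₑ ^ 2 = ∑' i, ‖⟪b i, x⟫_ℂ‖ₑ ^ 2 := by
  have h1 : HasSum (fun i => ‖⟪b i, x⟫_ℂ‖ ^ 2) (‖x‖ ^ 2) := by
    have h2 := (b.hasSum_inner_mul_inner x x).mapL Complex.reCLM
    simp only [Complex.reCLM_apply, inner_self_eq_norm_sq_to_K] at h2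
    convert h2 using 1
    · ext i
      rw [← inner_conj_symm x (b i), Complex.conj_mul']
      norm_cast
    · norm_cast
  have h3 : ∀ r : ℝ, 0 ≤ r → ∀ y : ENNReal, ENNReal.ofReal r = y →
      ENNReal.ofReal (r ^ 2) = y ^ 2 := fun r hr y hy => by
    rw [ENNReal.ofReal_pow hr, hy]
  rw [← h3 _ (norm_nonneg x) _ (ofReal_norm x), ← h1.tsum_eq,
    ENNReal.ofReal_tsum_of_nonneg (fun i => sq_nonneg _) h1.summable]
  exact tsum_congr fun i => h3 _ (norm_nonneg _) _ (ofReal_norm _)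

variable {H : Type u} [NormedAddCommGroup H] [InnerProductSpace ℂ H] [CompleteSpace H]
variable {K : Type v} [NormedAddCommGroup K] [InnerProductSpace ℂ K] [CompleteSpace K]

theorem scalarSpectralMeasure_eq_tsum {A : H →L[ℂ] H} (hA : IsSelfAdjoint A) {S : Set ℝ}
    (hS : MeasurableSet S) {ι : Type*} (b : HilbertBasis ι ℂ (spectralSubspace A S)) (x : H) :
    scalarSpectralMeasure A x S = ∑' i, ‖⟪(b i : H), x⟫_ℂ‖ₑ ^ 2 := by
  obtain ⟨y, hy, z, hz, rfl, h⟩ := exists_spectral_decomposition hA hS x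
  have h1 := b.enorm_sq_eq_tsum ⟨y, hy⟩
  rw [← h]
  refine Eq.trans h1 (tsum_congr fun i => ?_)
  rw [inner_add_right, inner_eq_zero_of_mem_compl hA hS (b i).2 hz, add_zero]
  rfl

theorem tsum_sigma_mul {α : Type*} {κ : α → Type*} (p : α → ENNReal)
    (f : (Σ a, κ a) → ENNReal) :
    ∑' i, p i.1 * f i = ∑' a, p a * ∑' k, f ⟨a, k⟩ := by
  rw [ENNReal.tsum_sigma']
  exact tsum_congr fun a => ENNReal.tsum_mul_left (a := p a) (f := fun k => f ⟨a, k⟩)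

/-- The operator `T` is, up to bounded factors, diagonal with respect to a Hilbert basis. -/
theorem exists_hilbertBasis_diagonal (T : H →L[ℂ] K) {lam : ℕ → ℝ≥0} (h : IsLogSeparated lam)
    (hb : ∃ C : ℝ≥0, ∀ k, lam k ≤ C * lam (k + 1)) :
    ∃ (b : HilbertBasis (discretization T lam h).Elem ℂ H) (C : ℝ≥0), ∀ x,
      ‖T x‖ₑ ^ 2 ≤ C ^ 2 * ∑' i, ((discretization T lam h).massPoint i.1 : ENNReal) ^ 2 *
        ‖⟪b i, x⟫_ℂ‖ₑ ^ 2 ∧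
      ∑' i, ((discretization T lam h).massPoint i.1 : ENNReal) ^ 2 * ‖⟪b i, x⟫_ℂ‖ₑ ^ 2 ≤
        C ^ 2 * ‖T x‖ₑ ^ 2 := by
  obtain ⟨C, -, hC⟩ := exists_logClose_of_mem_logPiece T h hb ‖absOp T‖₊
  have hA := isSelfAdjoint_absOp T
  let S : Option ℕ → Set ℝ := fun o => (fun t : ℝ≥0 => (t : ℝ)) '' logPiece lam o
  have hS : ∀ o, MeasurableSet (S o) := fun o =>
    measurableSet_coe_image (measurableSet_logPiece _ o)
  have hd : Pairwise (Function.onFun Disjoint S) := fun i j hij =>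
    (Set.disjoint_image_iff NNReal.coe_injective).2 (pairwise_disjoint_logPiece h hij)
  have hcs := fun o => completeSpace_spectralSubspace hA (S o)
  -- The bases are indexed by the chosen sets of units of mass, so that a matching of units is a
  -- matching of basis vectors.
  have hbasis : ∀ o, Nonempty (HilbertBasis ((discretization T lam h).massWeight o).out ℂ
      (spectralSubspace (absOp T) (S o))) := fun o => by
    apply exists_hilbertBasis_of_mk_eq
    rw [Cardinal.mk_out, massWeight_discretization]
    rfl
  have b := fun o => Classical.choice (hbasis o)
  have hV : OrthogonalFamily ℂ (fun o => spectralSubspace (absOp T) (S o))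
      fun o => (spectralSubspace (absOp T) (S o)).subtypeₗᵢ := fun i j hij x y =>
    inner_eq_zero_of_disjoint hA (hS i) (hd hij) x.2 y.2
  have hcover : ∀ x : H, ∀ᵐ t ∂(scalarSpectralMeasure (absOp T) x), t ∈ ⋃ o, S o := fun x => by
    filter_upwards [ae_mem_spectrum (absOp T) x] with t ht
    obtain ⟨o, ho⟩ := exists_mem_logPiece h ⟨t, nonneg_of_mem_spectrum_absOp T ht⟩
    exact Set.mem_iUnion.2 ⟨o, ⟨_, ho, rfl⟩⟩
  obtain ⟨d, hdb⟩ := exists_hilbertBasis_sigma hV b fun x hx =>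
    eq_zero_of_mem_spectralSubspace_iUnion hA hS (hcover x) fun o y hy => hx o ⟨y, hy⟩
  refine ⟨d, C, fun x => ?_⟩
  have hsum : ∑' i, ((discretization T lam h).massPoint i.1 : ENNReal) ^ 2 * ‖⟪d i, x⟫_ℂ‖ₑ ^ 2 =
      ∑' o, ((discretization T lam h).massPoint o : ENNReal) ^ 2 *
        scalarSpectralMeasure (absOp T) x (S o) := by
    refine (tsum_sigma_mul (fun o => ((discretization T lam h).massPoint o : ENNReal) ^ 2)
      fun i => ‖⟪d i, x⟫_ℂ‖ₑ ^ 2).trans (tsum_congr fun o => ?_)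
    rw [scalarSpectralMeasure_eq_tsum hA (hS o) (b o)]
    refine congrArg _ (tsum_congr fun k => ?_)
    rw [hdb]
    rfl
  have hT : ‖T x‖ₑ ^ 2 = ∑' o, ∫⁻ t in S o, ‖t‖ₑ ^ 2 ∂(scalarSpectralMeasure (absOp T) x) := by
    have h1 : ‖T x‖ₑ = ‖absOp T x‖ₑ := by
      rw [← ofReal_norm, ← ofReal_norm, norm_absOp]
    rw [h1, enorm_apply_sq hA, ← lintegral_iUnion hS hd, Measure.restrict_eq_self_of_ae_mem
      (hcover x)]
  -- On each piece, within the spectrum, `t` differs from the grid point by a factor at most `C`;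
  -- integrating this piece by piece gives both estimates.
  have hclose : ∀ o, ∀ᵐ t ∂((scalarSpectralMeasure (absOp T) x).restrict (S o)),
      ‖t‖ₑ ≤ C * ((discretization T lam h).massPoint o : ENNReal) ∧
      ((discretization T lam h).massPoint o : ENNReal) ≤ C * ‖t‖ₑ := fun o => by
    filter_upwards [ae_restrict_mem (hS o), ae_restrict_of_ae (ae_mem_spectrum (absOp T) x)]
      with t ht hts
    obtain ⟨r, hr, rfl⟩ := ht
    have hrC := hC o r hr (nnreal_le_nnnorm_of_mem_spectrum hts)
    have hre : ‖(r : ℝ)‖ₑ = r := by simp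
    rw [hre]
    exact ⟨by exact_mod_cast hrC.1, by exact_mod_cast hrC.2⟩
  rw [hsum, hT, ← ENNReal.tsum_mul_left, ← ENNReal.tsum_mul_left]
  constructor
  · refine ENNReal.tsum_le_tsum fun o => ?_
    rw [← mul_assoc, ← mul_pow]
    calc ∫⁻ t in S o, ‖t‖ₑ ^ 2 ∂(scalarSpectralMeasure (absOp T) x)
        ≤ ∫⁻ _t in S o, (C * ((discretization T lam h).massPoint o : ENNReal)) ^ 2
          ∂(scalarSpectralMeasure (absOp T) x) := by
          refine lintegral_mono_ae ?_
          filter_upwards [hclose o] with t ht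
          gcongr
          exact ht.1
      _ = _ := by rw [setLIntegral_const]
  · refine ENNReal.tsum_le_tsum fun o => ?_
    rw [← setLIntegral_const, ← lintegral_const_mul _ (by fun_prop)]
    refine lintegral_mono_ae ?_
    filter_upwards [hclose o] with t ht
    rw [← mul_pow]
    gcongr
    exact ht.2

variable {H₁ H₂ : Type u} {K₁ K₂ : Type v}
  [NormedAddCommGroup H₁] [InnerProductSpace ℂ H₁] [NormedAddCommGroup H₂] [InnerProductSpace ℂ H₂]
  [NormedAddCommGroup K₁] [InnerProductSpace ℂ K₁] [NormedAddCommGroup K₂] [InnerProductSpace ℂ K₂]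
  [CompleteSpace H₁] [CompleteSpace H₂] [CompleteSpace K₁] [CompleteSpace K₂]
  {T₁ : H₁ →L[ℂ] K₁} {T₂ : H₂ →L[ℂ] K₂}

theorem tsum_weighted_le_of_logClose {ι : Type*} {C : ℝ≥0} {p q : ι → ℝ≥0}
    (h : ∀ i, p i ≤ C * q i) (r : ι → ENNReal) :
    ∑' i, (p i : ENNReal) ^ 2 * r i ≤ C ^ 2 * ∑' i, (q i : ENNReal) ^ 2 * r i := by
  rw [← ENNReal.tsum_mul_left]
  refine ENNReal.tsum_le_tsum fun i => ?_
  rw [← mul_assoc, ← mul_pow]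
  gcongr
  exact_mod_cast h i

theorem norm_le_of_enorm_sq_le {X Y : Type*} [NormedAddCommGroup X] [NormedAddCommGroup Y] {x : X}
    {y : Y} {c d : ℝ≥0} (hcd : c ≤ d) (h : ‖x‖ₑ ^ 2 ≤ (c : ENNReal) ^ 2 * ‖y‖ₑ ^ 2) :
    ‖x‖ ≤ d * ‖y‖ := by
  rw [← mul_pow] at h
  have h' : ‖x‖ₑ ≤ c * ‖y‖ₑ := (ENNReal.pow_right_strictMono two_ne_zero).le_iff_le.1 h
  change (‖x‖₊ : ENNReal) ≤ c * ‖y‖₊ at h'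
  have h2 : ‖x‖₊ ≤ c * ‖y‖₊ := by exact_mod_cast h'
  have h3 : ‖x‖ ≤ c * ‖y‖ := h2
  refine h3.trans ?_
  gcongr

/-- `U` is the unitary sending `b₁ i` to `b₂ (e i)`. The diagonal weights at `i` and `e i` are
log-close, and the constants of the two diagonalisations and of `e` multiply. -/
theorem MutuallySpread.exists_normComparable {lam : ℕ → ℝ≥0} (hlam : IsLogSeparated lam)
    (hb : ∃ C : ℝ≥0, ∀ k, lam k ≤ C * lam (k + 1))
    (h : MutuallySpread (discretization T₁ lam hlam).toMeasure
      (discretization T₂ lam hlam).toMeasure) :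
    ∃ U c, NormComparable T₁ T₂ U c := by
  obtain ⟨C, e, -, he⟩ := EigenvalueSequence.exists_equiv_logClose h
  obtain ⟨b₁, C₁, hC₁⟩ := exists_hilbertBasis_diagonal T₁ hlam hb
  obtain ⟨b₂, C₂, hC₂⟩ := exists_hilbertBasis_diagonal T₂ hlam hb
  let U : H₁ ≃ₗᵢ[ℂ] H₂ := b₁.repr.trans (b₂.reindex e).repr.symm
  have hU : ∀ x i, ⟪b₂ (e i), U x⟫_ℂ = ⟪b₁ i, x⟫_ℂ := fun x i => by
    rw [← b₂.reindex_apply e, ← HilbertBasis.repr_apply_apply, ← HilbertBasis.repr_apply_apply]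
    simp [U]
  have hs₂ : ∀ x, ∑' j, ((discretization T₂ lam hlam).massPoint j.1 : ENNReal) ^ 2 *
      ‖⟪b₂ j, U x⟫_ℂ‖ₑ ^ 2 =
      ∑' i, ((discretization T₂ lam hlam).massPoint (e i).1 : ENNReal) ^ 2 *
        ‖⟪b₁ i, x⟫_ℂ‖ₑ ^ 2 := fun x => by
    rw [← e.tsum_eq]
    exact tsum_congr fun i => by rw [hU]
  -- The maximum with `1` lets a single constant also cover the norms of `U` and its inverse.
  have hle₁ : C₁ * C * C₂ ≤ max 1 (C₁ * C * C₂) := le_max_right _ _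
  have hle₂ : C₂ * C * C₁ ≤ max 1 (C₁ * C * C₂) := by
    rw [mul_right_comm, mul_comm C₂ C₁, mul_right_comm]
    exact le_max_right _ _
  have hone : ∀ (x : H₁), ‖x‖ ≤ (max 1 (C₁ * C * C₂) : ℝ≥0) * ‖x‖ := fun x =>
    le_mul_of_one_le_left (norm_nonneg x) (by exact_mod_cast le_max_left _ _)
  refine ⟨U.toContinuousLinearEquiv, max 1 (C₁ * C * C₂), fun x => ?_, fun x => ?_, fun x => ?_,
    fun x => ?_⟩
  · rw [show ‖U.toContinuousLinearEquiv x‖ = ‖x‖ from U.norm_map x]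
    exact hone x
  · rw [show ‖U.toContinuousLinearEquiv x‖ = ‖x‖ from U.norm_map x]
    exact hone x
  · refine norm_le_of_enorm_sq_le hle₁ ?_
    push_cast
    rw [mul_pow, mul_pow, mul_assoc, mul_assoc]
    refine (hC₁ x).1.trans ?_
    gcongr
    refine (tsum_weighted_le_of_logClose (fun i => (he i).1) _).trans ?_
    gcongr
    rw [← hs₂]
    exact (hC₂ (U x)).2
  · refine norm_le_of_enorm_sq_le hle₂ ?_
    push_cast
    rw [mul_pow, mul_pow, mul_assoc, mul_assoc]
    refine (hC₂ (U x)).1.trans ?_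
    gcongr
    rw [hs₂]
    refine (tsum_weighted_le_of_logClose (fun i => (he i).2) _).trans ?_
    gcongr
    exact (hC₁ x).2

theorem isLogSeparated_inv_two_pow : IsLogSeparated fun k => (2⁻¹ : ℝ≥0) ^ k where
  pos k := by positivity
  strictAnti := pow_right_strictAnti₀ (by positivity) (inv_lt_one_of_one_lt₀ one_lt_two)
  tendsto_zero := NNReal.tendsto_pow_atTop_nhds_zero_of_lt_one (inv_lt_one_of_one_lt₀ one_lt_two)
  separated := ⟨2, one_lt_two, fun k => by
    rw [pow_succ', ← mul_assoc, mul_inv_cancel₀ two_ne_zero, one_mul]⟩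

/-- Both directions are chains of `MutuallySpread`. The converse detours through roundings to the
common grid of powers of `1 / 2`, because the ratios of the points of `s₁` and `s₂` may be
unbounded, whereas diagonalisation needs bounded ones. -/
theorem exists_normComparable_iff {s₁ s₂ : EigenvalueSequence.{u}} (h₁ : s₁.IsOf T₁)
    (h₂ : s₂.IsOf T₂) :
    (∃ U c, NormComparable T₁ T₂ U c) ↔ LogBoundedShift s₁.toMeasure s₂.toMeasure := by
  have hs₁ : MutuallySpread (dimSpectralMeasure T₁) s₁.toMeasure :=
    LogBoundedShift.mutuallySpread h₁
  have hs₂ : MutuallySpread (dimSpectralMeasure T₂) s₂.toMeasure :=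
    LogBoundedShift.mutuallySpread h₂
  constructor
  · rintro ⟨U, c, h⟩
    exact EigenvalueSequence.logBoundedShift_of_mutuallySpread
      ((hs₁.symm.trans h.mutuallySpread).trans hs₂)
  · intro h
    have hlam := isLogSeparated_inv_two_pow
    have hb : ∃ C : ℝ≥0, ∀ k, (2⁻¹ : ℝ≥0) ^ k ≤ C * 2⁻¹ ^ (k + 1) := ⟨2, fun k => by
      rw [pow_succ', ← mul_assoc, mul_inv_cancel₀ two_ne_zero, one_mul]⟩
    have ht₁ := LogBoundedShift.mutuallySpread (discretization_isOf T₁ hlam hb)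
    have ht₂ := LogBoundedShift.mutuallySpread (discretization_isOf T₂ hlam hb)
    exact MutuallySpread.exists_normComparable hlam hb
      ((((ht₁.symm.trans hs₁).trans h.mutuallySpread).trans hs₂.symm).trans ht₂)

end Diagonal

/-! ### The main theorem -/

theorem mainTheorem1
    {H₁ H₂ : Type u} {K₁ K₂ : Type v}
    [NormedAddCommGroup H₁] [InnerProductSpace ℂ H₁] [CompleteSpace H₁]
    [NormedAddCommGroup H₂] [InnerProductSpace ℂ H₂] [CompleteSpace H₂]
    [NormedAddCommGroup K₁] [InnerProductSpace ℂ K₁] [CompleteSpace K₁]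
    [NormedAddCommGroup K₂] [InnerProductSpace ℂ K₂] [CompleteSpace K₂]
    (T₁ : H₁ →L[ℂ] K₁) (T₂ : H₂ →L[ℂ] K₂) :
    (∀ lam : ℕ → ℝ≥0, IsLogSeparated lam → (∃ C : ℝ≥0, ∀ k, lam k ≤ C * lam (k + 1)) →
      (∃ s₁ : EigenvalueSequence.{u}, s₁.point = lam ∧ s₁.IsOf T₁) ∧
      (∃ s₂ : EigenvalueSequence.{u}, s₂.point = lam ∧ s₂.IsOf T₂)) ∧
    ∀ s₁ s₂ : EigenvalueSequence.{u}, s₁.IsOf T₁ → s₂.IsOf T₂ →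
      (TopEquivalent (toClosureRange T₁) (toClosureRange T₂) ↔
        LogBoundedShift s₁.toMeasure s₂.toMeasure) ∧
      (TopEquivalent T₁ T₂ ↔
        LogBoundedShift s₁.toMeasure s₂.toMeasure ∧
        hilbertDim (LinearMap.range T₁.toLinearMap)ᗮ =
          hilbertDim (LinearMap.range T₂.toLinearMap)ᗮ) := by
  refine ⟨fun lam h hb => ⟨⟨discretization T₁ lam h, rfl, discretization_isOf T₁ h hb⟩,
    ⟨discretization T₂ lam h, rfl, discretization_isOf T₂ h hb⟩⟩, fun s₁ s₂ h₁ h₂ => ?_⟩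
  rw [← exists_normComparable_iff h₁ h₂]
  refine ⟨⟨fun h => h.normComparable (norm_toClosureRange T₁) (norm_toClosureRange T₂), ?_⟩,
    fun h => ⟨h.normComparable (fun _ => rfl) (fun _ => rfl),
      le_antisymm h.hilbertDim_orthogonal_le h.symm.hilbertDim_orthogonal_le⟩, ?_⟩
  · rintro ⟨U, c, h⟩
    exact h.topEquivalent_toClosureRange
  · rintro ⟨⟨U, c, h⟩, hdim⟩
    exact h.topEquivalent hdim
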